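/- **Setting.** Let $\mathcal E$ be a finite-dimensional Euclidean space with inner product $\langle\cdot,\cdot\rangle$, let $\|\cdot\|$ be any norm on $\mathcal E$ and $\|\xi\|_*=\max_{\|z\|\le 1}\langle\xi,z\rangle$ its conjugate norm. Let $Z\subset\mathcal E$ be a nonempty convex compact set, and let $F:Z\to\mathcal E$ be a Borel map that is monotone, $\langle F(z)-F(z'),z-z'\rangle\ge 0$, and satisfies $\|F(z)-F(z')\|_*\le L\|z-z'\|+M$ for all $z,z'\in Z$, where $L,M\ge 0$. Put $\mathrm{Err}_{\mathrm{vi}}(z)=\sup_{u\in Z}\langle F(u),z-u\rangle$. *Prox-setup.* Let $\omega:Z\to\mathbb R$ be a distance-generating function: $\omega$ is continuous and convex; with $Z^o$ the set of $z\in Z$ at which the subdifferential $\partial\omega(z)=\{g:\omega(u)\ge\omega(z)+\langle g,u-z\rangle\ \forall u\in Z\}$ is nonempty, there is a (fixed) continuous selection $\omega':Z^o\to\mathcal E$, $\omega'(z)\in\partial\omega(z)$; and for some $\alpha>0$, $\langle\omega'(z)-\omega'(z'),z-z'\rangle\ge\alpha\|z-z'\|^2$ for all $z,z'\in Z^o$.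 Put $V(z,u)=\omega(u)-\omega(z)-\langle\omega'(z),u-z\rangle$ for $z\in Z^o,u\in Z$, $z_c=\mathrm{argmin}_Z\,\omega$, $\Theta=\max_{u\in Z}V(z_c,u)$, $\Omega=\sqrt{2\Theta/\alpha}$, and $P(z,\xi)=\mathrm{argmin}_{u\in Z}\{V(z,u)+\langle\xi,u\rangle\}$. *Algorithm.* Let $\zeta_1,\zeta_2,\dots$ be i.i.d. random vectors in $\mathbb R^N$, let $\Xi:Z\times\mathbb R^N\to\mathcal E$ be Borel (the stochastic oracle), let $t\ge 1$ be an integer, and let the constant stepsize $\gamma>0$ satisfy $\sqrt3\,L\gamma\le\alpha$ (i.e. $\gamma\le\alpha/(\sqrt3L)$, which is no restriction if $L=0$). The $t$-step Stochastic Mirror-Prox algorithm sets $r_0=z_c$ and, for $\tau=1,\dots,t$, $$w_\tau=P\big(r_{\tau-1},\gamma\,\Xi(r_{\tau-1},\zeta_{2\tau-1})\big),\qquad r_\tau=P\big(r_{\tau-1},\gamma\,\Xi(w_\tau,\zeta_{2\tau})\big),$$ and outputs $\widehat z_t=\frac1t\sum_{\tau=1}^t w_\tau$. *Assumption I* (with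 a constant $\mu\in[0,\infty)$): for all $z\in Z$ and all $i$, $\|\mathbf E\{\Xi(z,\zeta_i)-F(z)\}\|_*\le\mu$ and $\mathbf E\{\|\Xi(z,\zeta_i)-F(z)\|_*^2\}\le M^2$. *Assumption II*: for all $z\in Z$ and all $i$, $\mathbf E\{\exp(\|\Xi(z,\zeta_i)-F(z)\|_*^2/M^2)\}\le\exp(1)$ (no condition if $M=0$). Here $M$ is the same constant as in the bound on $F$. *Nash v.i.* The v.i. is a Nash v.i. if $\mathcal E=\mathcal E_1\times\dots\times\mathcal E_m$ is a Euclidean direct product, $Z=Z_1\times\dots\times Z_m$ with convex compact $Z_i\subset\mathcal E_i$, and there are Lipschitz continuous functions $\phi_i:Z\to\mathbb R$ such that $\phi_i(z)=\phi_i(z_i,z^i)$ is convex in $z_i$ and concave in the collection $z^i$ of the other blocks, $\sum_i\phi_i$ is convex on $Z$, and $F(z)=[F^1(z);\dots;F^m(z)]$ with $F^i(z)$ in the subdifferential of $\phi_i(\cdot,z^i)$ on $Z_i$ at $z_i$. In this case $\mathrm{Err}_{\mathrm N}(z)=\sum_{i=1}^m\big[\phi_i(z)-\min_{x\in Z_i}\phi_i(x,z^i)\big]$.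 **Theorem.** In this setting: (i) Under Assumption I, $\mathrm{Err}_{\mathrm{vi}}(\widehat z_t)$ is integrable and $$\mathbf E\{\mathrm{Err}_{\mathrm{vi}}(\widehat z_t)\}\le K_0(t)\equiv\Big[\frac{\alpha\Omega^2}{t\gamma}+\frac{21M^2\gamma}{2\alpha}\Big]+2\mu\Omega.$$ (ii) Under Assumptions I and II, in addition, for every $\Lambda>0$, $$\mathrm{Prob}\{\mathrm{Err}_{\mathrm{vi}}(\widehat z_t)>K_0(t)+\Lambda K_1(t)\}\le\exp\{-\Lambda^2/3\}+\exp\{-\Lambda t\},\qquad K_1(t)=\frac{7M^2\gamma}{2\alpha}+\frac{2M\Omega}{\sqrt t}.$$ In the case of a Nash v.i., $\mathrm{Err}_{\mathrm{vi}}$ can be replaced with $\mathrm{Err}_{\mathrm N}$ in (i) and (ii). -/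

import Mathlib

open MeasureTheory ProbabilityTheory
open scoped RealInnerProductSpace

namespace SMP

noncomputable section

section Deterministic

variable {E : Type*} [NormedAddCommGroup E] [InnerProductSpace ℝ E]

/-- The norm conjugate to `p`: `‖ξ‖_* = max {⟪ξ, z⟫ : p z ≤ 1}`. -/
def conjNorm (p : Seminorm ℝ E) (ξ : E) : ℝ := ⨆ z : {z : E // p z ≤ 1}, ⟪ξ, (z : E)⟫

/-- The v.i. error `Err_vi(z) = sup_{u ∈ Z} ⟪F u, z - u⟫`. -/
def errVI (Z : Set E) (F : E → E) (z : E) : ℝ := ⨆ u : Z, ⟪F u, z - (u : E)⟫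

/-- The subdifferential at `z` of a function `f` considered on the set `Z` only. -/
def subdiff (Z : Set E) (f : E → ℝ) (z : E) : Set E :=
  {g | ∀ u ∈ Z, f z + ⟪g, u - z⟫ ≤ f u}

/-- `Z^o`: the points of `Z` at which the subdifferential of `ω` is nonempty. -/
def subdiffDomain (Z : Set E) (ω : E → ℝ) : Set E := {z ∈ Z | (subdiff Z ω z).Nonempty}

/-- `ω` is a distance-generating function for `Z`, strongly convex with modulus `α` with respect to
the norm `p`, and `ω'` is the fixed continuous selection of its subdifferential. -/
structure IsDistGen (p : Seminorm ℝ E) (Z : Set E) (ω : E → ℝ) (ω' : E → E) (α : ℝ) : Prop where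
  continuousOn : ContinuousOn ω Z
  convexOn : ConvexOn ℝ Z ω
  selection : ∀ z ∈ subdiffDomain Z ω, ω' z ∈ subdiff Z ω z
  selection_continuousOn : ContinuousOn ω' (subdiffDomain Z ω)
  modulus_pos : 0 < α
  strong : ∀ z ∈ subdiffDomain Z ω, ∀ z' ∈ subdiffDomain Z ω,
    α * p (z - z') ^ 2 ≤ ⟪ω' z - ω' z', z - z'⟫

/-- The prox-function `V(z, u)`. -/
def proxFun (ω : E → ℝ) (ω' : E → E) (z u : E) : ℝ := ω u - ω z - ⟪ω' z, u - z⟫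

/-- A minimizer of `f` on `Z` (an arbitrary point of `E` if there is none). -/
def argminOn (f : E → ℝ) (Z : Set E) : E := Classical.epsilon fun z => z ∈ Z ∧ IsMinOn f Z z

/-- `z_c`, the minimizer of `ω` on `Z`. -/
def center (Z : Set E) (ω : E → ℝ) : E := argminOn ω Z

/-- `Θ(z) = max_{u ∈ Z} V(z, u)`. -/
def Theta (Z : Set E) (ω : E → ℝ) (ω' : E → E) (z : E) : ℝ := ⨆ u : Z, proxFun ω ω' z u

/-- `Ω = √(2 Θ(z_c) / α)`. -/
def Omega (Z : Set E) (ω : E → ℝ) (ω' : E → E) (α : ℝ) : ℝ :=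
  √(2 * Theta Z ω ω' (center Z ω) / α)

/-- The prox-mapping `P(z, ξ) = argmin_{u ∈ Z} {V(z, u) + ⟪ξ, u⟫}`. -/
def prox (Z : Set E) (ω : E → ℝ) (ω' : E → E) (z ξ : E) : E :=
  argminOn (fun u => proxFun ω ω' z u + ⟪ξ, u⟫) Z

/-- The intermediate point `w` of a step starting at `r` with stepsize `g`, where the oracle `Ξ` is
called at `r` with noise realization `x`. -/
def halfStep {S : Type*} (Z : Set E) (ω : E → ℝ) (ω' : E → E) (Ξ : E → S → E)
    (g : ℝ) (r : E) (x : S) : E :=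
  prox Z ω ω' r (g • Ξ r x)

/-- The points `r_τ` of the Stochastic Mirror-Prox algorithm with start point `r₀`, stepsizes
`γ τ` (for the step leading from `r_τ` to `r_{τ+1}`), and realization `s` of the noise sequence;
this step uses the fresh entries `s (2 τ)` and `s (2 τ + 1)` in its two oracle calls. -/
def smpR {S : Type*} (Z : Set E) (ω : E → ℝ) (ω' : E → E) (Ξ : E → S → E)
    (r₀ : E) (γ : ℕ → ℝ) (s : ℕ → S) : ℕ → E
  | 0 => r₀
  | τ + 1 =>
    let r := smpR Z ω ω' Ξ r₀ γ s τ
    prox Z ω ω' r (γ τ • Ξ (halfStep Z ω ω' Ξ (γ τ) r (s (2 * τ))) (s (2 * τ + 1)))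

/-- The intermediate point `w` of the step leading from `r_τ` to `r_{τ+1}`. -/
def smpW {S : Type*} (Z : Set E) (ω : E → ℝ) (ω' : E → E) (Ξ : E → S → E)
    (r₀ : E) (γ : ℕ → ℝ) (s : ℕ → S) (τ : ℕ) : E :=
  halfStep Z ω ω' Ξ (γ τ) (smpR Z ω ω' Ξ r₀ γ s τ) (s (2 * τ))

/-- The output of the `t`-step algorithm: the weighted average of the intermediate points. -/
def smpOutput {S : Type*} (Z : Set E) (ω : E → ℝ) (ω' : E → E) (Ξ : E → S → E)
    (r₀ : E) (γ : ℕ → ℝ) (s : ℕ → S) (t : ℕ) : E :=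
  (∑ τ ∈ Finset.range t, γ τ)⁻¹ • ∑ τ ∈ Finset.range t, γ τ • smpW Z ω ω' Ξ r₀ γ s τ

end Deterministic

section Oracle

variable {E : Type*} [NormedAddCommGroup E] [InnerProductSpace ℝ E]

/-- Assumption I: oracle bias at most `μ`, second moment of the oracle error at most `M ^ 2`. -/
structure AssumptionI {S W : Type*} [MeasurableSpace W] (p : Seminorm ℝ E) (Z : Set E)
    (F : E → E) (Ξ : E → S → E) (P : Measure W) (ζ : ℕ → W → S) (μ M : ℝ) : Prop where
  bias : ∀ z ∈ Z, ∀ i, conjNorm p (∫ x, (Ξ z (ζ i x) - F z) ∂P) ≤ μ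
  moment : ∀ z ∈ Z, ∀ i,
    ∫⁻ x, ENNReal.ofReal (conjNorm p (Ξ z (ζ i x) - F z) ^ 2) ∂P ≤ ENNReal.ofReal (M ^ 2)

/-- Assumption II: the oracle error is sub-Gaussian with scale `M`. -/
def AssumptionII {S W : Type*} [MeasurableSpace W] (p : Seminorm ℝ E) (Z : Set E)
    (F : E → E) (Ξ : E → S → E) (P : Measure W) (ζ : ℕ → W → S) (M : ℝ) : Prop :=
  ∀ z ∈ Z, ∀ i,
    ∫⁻ x, ENNReal.ofReal (Real.exp (conjNorm p (Ξ z (ζ i x) - F z) ^ 2 / M ^ 2)) ∂P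
      ≤ ENNReal.ofReal (Real.exp 1)

end Oracle

/-- `K_0(t)`, where `Om` stands for `Ω`. -/
def K0 (α Om M μ γ : ℝ) (t : ℕ) : ℝ :=
  (α * Om ^ 2 / (t * γ) + 21 * M ^ 2 * γ / (2 * α)) + 2 * μ * Om

/-- `K_1(t)`, where `Om` stands for `Ω`. -/
def K1 (α Om M γ : ℝ) (t : ℕ) : ℝ := 7 * M ^ 2 * γ / (2 * α) + 2 * M * Om / √t

section Nash

variable {m : ℕ} {H : Fin m → Type*} [∀ i, NormedAddCommGroup (H i)]
  [∀ i, InnerProductSpace ℝ (H i)]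

/-- The collection of choices `(x, z^i)`: the `i`-th block of `z` is replaced with `x`. -/
def deviate (z : PiLp 2 H) (i : Fin m) (x : H i) : PiLp 2 H :=
  WithLp.toLp 2 (Function.update (WithLp.ofLp z) i x)

/-- The product `Z_1 × ... × Z_m` of the players' sets in the Euclidean direct product. -/
def prodSet (X : ∀ i, Set (H i)) : Set (PiLp 2 H) := {z | ∀ i, z i ∈ X i}

/-- The Nash equilibrium problem with strategy sets `X i` and losses `φ i` is convex. -/
structure IsConvexNash (X : ∀ i, Set (H i)) (φ : Fin m → PiLp 2 H → ℝ) : Prop where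
  isCompact : ∀ i, IsCompact (X i)
  convex : ∀ i, Convex ℝ (X i)
  lipschitz : ∀ i, ∃ K : NNReal, LipschitzOnWith K (φ i) (prodSet X)
  convex_own : ∀ i, ∀ z ∈ prodSet X, ConvexOn ℝ (X i) fun x => φ i (deviate z i x)
  concave_others : ∀ i, ∀ x ∈ X i, ConcaveOn ℝ {z ∈ prodSet X | z i = x} (φ i)
  convex_sum : ConvexOn ℝ (prodSet X) fun z => ∑ i, φ i z

/-- `F` is an operator of the Nash v.i.: `F^i(z)` is a subgradient of `φ_i(·, z^i)` at `z_i`. -/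
def IsNashOperator (X : ∀ i, Set (H i)) (φ : Fin m → PiLp 2 H → ℝ)
    (F : PiLp 2 H → PiLp 2 H) : Prop :=
  ∀ z ∈ prodSet X, ∀ i, F z i ∈ subdiff (X i) (fun x => φ i (deviate z i x)) (z i)

/-- The functional error `Err_N(z) = ∑ i, [φ_i(z) - min_{x ∈ Z_i} φ_i(x, z^i)]`. -/
def errN (X : ∀ i, Set (H i)) (φ : Fin m → PiLp 2 H → ℝ) (z : PiLp 2 H) : ℝ :=
  ∑ i, (φ i z - ⨅ x : X i, φ i (deviate z i x))

end Nash

end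

end SMP

/-! Convergence is a regret argument. Write `Δ` for the oracle error at `w_τ`. A prox-step satisfies
the three-point inequality `inner_prox_sub_le`, and `le_proxFun` makes `V` dominate the squared
distance. Combining the two prox-steps issued from `r_{τ-1}` bounds `γ⟪Ξ(w), w - u⟫` by a decrease
of `V(r, u)`, plus `γ²/(2α)` times the squared difference of the two oracle values, minus `α/2 · p(w
- r)²`. The stepsize condition lets the last term absorb the Lipschitz part of that difference,
leaving only `M²` and squared oracle errors.

Replacing `Ξ(w)` by `F(w)` costs `⟪Δ, w - u⟫`, and the worst `u` depends on all the noise, so no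
expectation can be taken directly. An auxiliary prox-sequence `y` driven by `-γΔ` settles this: `⟪Δ,
y - u⟫` is controlled by its own regret, uniformly in `u`, while in `⟪Δ, y - w⟫` both points precede
the noise entering `Δ`. The results are `step_le` and, summed, `sum_inner_le`; the two potentials
start at `Θ` each, whence `2Θ = αΩ²`.

Monotonicity (`errVI_average_le`), or the convexity structure of a Nash problem (`errN_average_le`),
turns regret into error of the average. It remains to estimate two random sums in `error_bounds`.
Second moments and bias give the expectation. For deviations, exponential moments are multiplied up
one fresh noise at a time: the squared errors contribute `exp(-Λt)`, and the linear terms, through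
the sub-Gaussian bound `lintegral_exp_mul_le`, contribute `exp(-Λ²/3)`. -/

namespace SMP

open Filter Topology Set
open scoped ENNReal

/-! ### The conjugate norm and equivalence of norms. -/

section Norms

variable {E : Type*} [NormedAddCommGroup E] [InnerProductSpace ℝ E] {p : Seminorm ℝ E}

theorem conjNorm_le {ξ : E} {c : ℝ} (h : ∀ z, p z ≤ 1 → ⟪ξ, z⟫ ≤ c) : conjNorm p ξ ≤ c := by
  have : Nonempty {z : E // p z ≤ 1} := ⟨⟨0, by simp⟩⟩
  exact ciSup_le fun z => h z z.2

theorem conjNorm_neg (ξ : E) : conjNorm p (-ξ) = conjNorm p ξ := by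
  have key : ∀ ξ : E, (range fun z : {z : E // p z ≤ 1} => ⟪-ξ, (z : E)⟫) ⊆
      range fun z : {z : E // p z ≤ 1} => ⟪ξ, (z : E)⟫ := by
    rintro ξ _ ⟨z, rfl⟩
    exact ⟨⟨-z, by simpa using z.2⟩, by simp⟩
  refine congrArg sSup (Subset.antisymm (key ξ) ?_)
  simpa using key (-ξ)

variable [FiniteDimensional ℝ E]

theorem seminorm_continuous (p : Seminorm ℝ E) : Continuous p :=
  continuousOn_univ.1 (ConvexOn.continuousOn isOpen_univ p.convexOn)

theorem exists_norm_le (hp : ∀ x, p x = 0 → x = 0) : ∃ D : ℝ, 0 ≤ D ∧ ∀ x, ‖x‖ ≤ D * p x := by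
  rcases subsingleton_or_nontrivial E with hE | hE
  · exact ⟨0, le_rfl, fun x => by simp [Subsingleton.elim x 0]⟩
  obtain ⟨z, hz, hmin⟩ := (isCompact_sphere (0 : E) 1).exists_isMinOn
    (NormedSpace.sphere_nonempty.2 zero_le_one) (seminorm_continuous p).continuousOn
  have hz1 : ‖z‖ = 1 := by simpa using hz
  have hpz : 0 < p z := by
    refine lt_of_le_of_ne (apply_nonneg p z) fun h => ?_
    simp [hp z h.symm] at hz1
  refine ⟨(p z)⁻¹, by positivity, fun x => ?_⟩
  rcases eq_or_ne x 0 with rfl | hx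
  · simp
  have hx' : 0 < ‖x‖ := norm_pos_iff.2 hx
  have h : p z ≤ p (‖x‖⁻¹ • x) := hmin (by simp [norm_smul, hx'.ne'])
  rw [map_smul_eq_mul, norm_inv, norm_norm] at h
  rw [inv_mul_eq_div, le_div_iff₀ hpz]
  calc ‖x‖ * p z ≤ ‖x‖ * (‖x‖⁻¹ * p x) := by gcongr
    _ = p x := by field_simp

theorem conjNorm_bddAbove (hp : ∀ x, p x = 0 → x = 0) (ξ : E) :
    BddAbove (range fun z : {z : E // p z ≤ 1} => ⟪ξ, (z : E)⟫) := by
  obtain ⟨D, hD, h⟩ := exists_norm_le hp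
  refine ⟨‖ξ‖ * D, ?_⟩
  rintro _ ⟨z, rfl⟩
  refine (real_inner_le_norm _ _).trans ?_
  gcongr
  exact (h z).trans (by nlinarith [z.2])

theorem conjNorm_nonneg (hp : ∀ x, p x = 0 → x = 0) (ξ : E) : 0 ≤ conjNorm p ξ := by
  have := le_ciSup (conjNorm_bddAbove hp ξ) ⟨0, by simp⟩
  simpa [conjNorm] using this

theorem inner_le_conjNorm (hp : ∀ x, p x = 0 → x = 0) (ξ z : E) :
    ⟪ξ, z⟫ ≤ conjNorm p ξ * p z := by
  rcases eq_or_ne z 0 with rfl | hz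
  · simp
  have hpz : 0 < p z := lt_of_le_of_ne (apply_nonneg p z) fun h => hz (hp z h.symm)
  have h := le_ciSup (conjNorm_bddAbove hp ξ) ⟨(p z)⁻¹ • z, by
    rw [map_smul_eq_mul, norm_inv, Real.norm_of_nonneg hpz.le, inv_mul_cancel₀ hpz.ne']⟩
  change ⟪ξ, (p z)⁻¹ • z⟫ ≤ conjNorm p ξ at h
  rw [inner_smul_right, inv_mul_eq_div, div_le_iff₀ hpz] at h
  exact h

theorem inner_le_conjNorm_of_le_one (hp : ∀ x, p x = 0 → x = 0) (ξ : E) {z : E} (hz : p z ≤ 1) :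
    ⟪ξ, z⟫ ≤ conjNorm p ξ :=
  le_ciSup (conjNorm_bddAbove hp ξ) ⟨z, hz⟩

theorem abs_inner_le_conjNorm (hp : ∀ x, p x = 0 → x = 0) (ξ : E) {v : E} (hv : p v ≤ 1) :
    |⟪ξ, v⟫| ≤ conjNorm p ξ := by
  refine abs_le.2 ⟨?_, inner_le_conjNorm_of_le_one hp ξ hv⟩
  have := inner_le_conjNorm_of_le_one hp ξ (z := -v) (by simpa using hv)
  rw [inner_neg_right] at this
  linarith

theorem conjNorm_add_le (hp : ∀ x, p x = 0 → x = 0) (ξ η : E) :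
    conjNorm p (ξ + η) ≤ conjNorm p ξ + conjNorm p η :=
  conjNorm_le fun z hz => by
    rw [inner_add_left]
    exact add_le_add (inner_le_conjNorm_of_le_one hp ξ hz) (inner_le_conjNorm_of_le_one hp η hz)

theorem conjNorm_sub_le (hp : ∀ x, p x = 0 → x = 0) (ξ η : E) :
    conjNorm p (ξ - η) ≤ conjNorm p ξ + conjNorm p η := by
  simpa [sub_eq_add_neg, conjNorm_neg] using conjNorm_add_le hp ξ (-η)

theorem exists_conjNorm_le (hp : ∀ x, p x = 0 → x = 0) :
    ∃ D : ℝ, 0 ≤ D ∧ ∀ ξ : E, conjNorm p ξ ≤ D * ‖ξ‖ := by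
  obtain ⟨D, hD, h⟩ := exists_norm_le hp
  refine ⟨D, hD, fun ξ => conjNorm_le fun z hz => (real_inner_le_norm _ _).trans ?_⟩
  rw [mul_comm]
  gcongr
  exact (h z).trans (by nlinarith)

/-- Pairing `ξ` with itself gives `‖ξ‖² ≤ ‖ξ‖_* p(ξ) ≤ C ‖ξ‖_* ‖ξ‖`. -/
theorem exists_norm_le_conjNorm (hp : ∀ x, p x = 0 → x = 0) :
    ∃ C : ℝ, 0 ≤ C ∧ ∀ ξ : E, ‖ξ‖ ≤ C * conjNorm p ξ := by
  obtain ⟨C, hC, h⟩ := p.bound_of_continuous_normedSpace (seminorm_continuous p)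
  refine ⟨C, hC.le, fun ξ => ?_⟩
  rcases eq_or_ne ξ 0 with rfl | hξ
  · simpa using mul_nonneg hC.le (conjNorm_nonneg hp 0)
  have hξ' : 0 < ‖ξ‖ := norm_pos_iff.2 hξ
  have h1 := inner_le_conjNorm hp ξ ξ
  rw [real_inner_self_eq_norm_sq] at h1
  nlinarith [mul_le_mul_of_nonneg_left (h ξ) (conjNorm_nonneg hp ξ)]

theorem conjNorm_continuous (hp : ∀ x, p x = 0 → x = 0) : Continuous (conjNorm p) := by
  obtain ⟨D, hD, h⟩ := exists_conjNorm_le hp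
  refine (LipschitzWith.of_le_add_mul ⟨D, hD⟩ fun ξ η => ?_).continuous
  have := conjNorm_add_le hp η (ξ - η)
  rw [add_sub_cancel] at this
  rw [dist_eq_norm]
  exact this.trans (by gcongr; exact h _)

end Norms

/-! ### Relative interior and existence of subgradients. -/

section RelativeInterior

variable {E : Type*} [NormedAddCommGroup E] [InnerProductSpace ℝ E]

/-- The relative interior of `Z`: the points around which `Z` contains a ball of its affine hull. -/
def relInterior (Z : Set E) : Set E :=
  {x ∈ Z | ∃ r > 0, ∀ d ∈ (affineSpan ℝ Z).direction, ‖d‖ ≤ r → x + d ∈ Z}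

theorem relInterior_subset (Z : Set E) : relInterior Z ⊆ Z := fun _ h => h.1

theorem sub_mem_direction {Z : Set E} {x y : E} (hx : x ∈ Z) (hy : y ∈ Z) :
    x - y ∈ (affineSpan ℝ Z).direction :=
  AffineSubspace.vsub_mem_direction (subset_affineSpan ℝ Z hx) (subset_affineSpan ℝ Z hy)

theorem relInterior_nonempty [FiniteDimensional ℝ E] {Z : Set E} (hZ : Convex ℝ Z)
    (hne : Z.Nonempty) : (relInterior Z).Nonempty := by
  obtain ⟨x, hx⟩ := hne.intrinsicInterior hZ
  obtain ⟨y, hy, rfl⟩ := mem_intrinsicInterior.1 hx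
  rw [mem_interior_iff_mem_nhds, Metric.mem_nhds_iff] at hy
  obtain ⟨ε, hε, hball⟩ := hy
  refine ⟨y, hball (Metric.mem_ball_self hε), ε / 2, by positivity, fun d hd hdr => ?_⟩
  have hmem : (y : E) + d ∈ affineSpan ℝ Z := by
    have := AffineSubspace.vadd_mem_of_mem_direction hd y.2
    rwa [vadd_eq_add, add_comm] at this
  have : (⟨(y : E) + d, hmem⟩ : affineSpan ℝ Z) ∈ Metric.ball y ε := by
    rw [Metric.mem_ball, Subtype.dist_eq, dist_eq_norm]
    simp only [add_sub_cancel_left]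
    linarith
  exact hball this

/-- The homothety with center `z` and ratio `s` maps `Z` into itself and the ball of radius `r`
around `q` onto one of radius `s * r`. -/
theorem relInterior_segment {Z : Set E} (hZ : Convex ℝ Z) {z q : E} (hz : z ∈ Z)
    (hq : q ∈ relInterior Z) {s : ℝ} (hs : 0 < s) (hs1 : s ≤ 1) :
    z + s • (q - z) ∈ relInterior Z := by
  obtain ⟨hqZ, r, hr, h⟩ := hq
  have key : ∀ y ∈ Z, z + s • (y - z) ∈ Z := fun y hy => hZ.add_smul_sub_mem hz hy ⟨hs.le, hs1⟩
  refine ⟨key q hqZ, s * r, by positivity, fun d hd hdr => ?_⟩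
  have h1 : q + s⁻¹ • d ∈ Z := by
    refine h _ (Submodule.smul_mem _ _ hd) ?_
    rw [norm_smul, norm_inv, Real.norm_of_nonneg hs.le, inv_mul_le_iff₀ hs]
    exact hdr
  have h2 := key _ h1
  have : z + s • (q - z) + d = z + s • (q + s⁻¹ • d - z) := by
    rw [add_sub_right_comm, smul_add, smul_inv_smul₀ hs.ne', add_assoc]
  rwa [this]

/-- First-order optimality for the quadratic regularization of a convex function. -/
theorem smul_sub_mem_subdiff_of_isMinOn {Z : Set E} {ω : E → ℝ} (hω : ConvexOn ℝ Z ω) {c : ℝ}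
    {x v : E} (hv : v ∈ Z) (hmin : IsMinOn (fun u => ω u + c / 2 * ‖u - x‖ ^ 2) Z v) :
    c • (x - v) ∈ subdiff Z ω v := by
  intro u hu
  -- Minimality is tested at `v + s • (u - v)` and divided by `s`; the quadratic term leaves an
  -- error of order `s`, which vanishes in the limit.
  have key : ∀ s ∈ Ioo (0 : ℝ) 1,
      ω v + ⟪c • (x - v), u - v⟫ ≤ ω u + s * (c / 2 * ‖u - v‖ ^ 2) := by
    rintro s ⟨hs, hs1⟩
    have h1 : ω v + c / 2 * ‖v - x‖ ^ 2 ≤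
        ω (v + s • (u - v)) + c / 2 * ‖v + s • (u - v) - x‖ ^ 2 :=
      hmin (hω.1.add_smul_sub_mem hv hu ⟨hs.le, hs1.le⟩)
    have h2 : ω (v + s • (u - v)) ≤ (1 - s) * ω v + s * ω u := by
      have := hω.2 hv hu (sub_nonneg.2 hs1.le) hs.le (by ring)
      rwa [show (1 - s) • v + s • u = v + s • (u - v) by module] at this
    have h3 : ‖v + s • (u - v) - x‖ ^ 2 =
        ‖v - x‖ ^ 2 + 2 * s * ⟪v - x, u - v⟫ + s ^ 2 * ‖u - v‖ ^ 2 := by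
      rw [show v + s • (u - v) - x = (v - x) + s • (u - v) by abel, norm_add_sq_real,
        inner_smul_right, norm_smul, mul_pow, Real.norm_eq_abs, sq_abs]
      ring
    have h4 : ⟪c • (x - v), u - v⟫ = -(c * ⟪v - x, u - v⟫) := by
      rw [real_inner_smul_left, ← neg_sub v x, inner_neg_left]
      ring
    rw [h3] at h1
    rw [h4]
    refine le_of_mul_le_mul_left ?_ hs
    nlinarith
  have hlim : Tendsto (fun s : ℝ => ω u + s * (c / 2 * ‖u - v‖ ^ 2)) (𝓝[>] 0) (𝓝 (ω u)) := by
    have : Continuous fun s : ℝ => ω u + s * (c / 2 * ‖u - v‖ ^ 2) := by fun_prop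
    simpa using (this.tendsto 0).mono_left nhdsWithin_le_nhds
  refine ge_of_tendsto hlim ?_
  filter_upwards [Ioo_mem_nhdsGT (zero_lt_one' ℝ)] with s hs using key s hs

/-- A continuous convex function on a compact convex set is subdifferentiable at each point of the
relative interior. -/
theorem relInterior_subset_subdiffDomain [FiniteDimensional ℝ E] {Z : Set E}
    (hZ : IsCompact Z) {ω : E → ℝ} (hc : ContinuousOn ω Z) (hω : ConvexOn ℝ Z ω) :
    relInterior Z ⊆ subdiffDomain Z ω := by
  rintro x ⟨hxZ, r, hr, hball⟩
  refine ⟨hxZ, ?_⟩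
  obtain ⟨B, hB⟩ := hZ.exists_bound_of_continuousOn hc
  -- The regularized minimizers `v n` carry explicit subgradients `n • (x - v n)` and converge to
  -- `x`; a limit point of these subgradients is a subgradient at `x`, once they are known to be
  -- bounded.
  have hex : ∀ n : ℕ, ∃ v ∈ Z, IsMinOn (fun u => ω u + (n : ℝ) / 2 * ‖u - x‖ ^ 2) Z v :=
    fun n => hZ.exists_isMinOn ⟨x, hxZ⟩ (by fun_prop)
  choose v hvZ hvmin using hex
  have hg : ∀ n : ℕ, (n : ℝ) • (x - v n) ∈ subdiff Z ω (v n) :=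
    fun n => smul_sub_mem_subdiff_of_isMinOn hω (hvZ n) (hvmin n)
  have habs : ∀ u ∈ Z, ∀ u' ∈ Z, ω u - ω u' ≤ 2 * B := fun u hu u' hu' => by
    have h1 := abs_le.1 (hB u hu)
    have h2 := abs_le.1 (hB u' hu')
    linarith
  have hdist : ∀ n : ℕ, (n : ℝ) * ‖v n - x‖ ^ 2 ≤ 4 * B := fun n => by
    have h1 : ω (v n) + (n : ℝ) / 2 * ‖v n - x‖ ^ 2 ≤ ω x + (n : ℝ) / 2 * ‖x - x‖ ^ 2 :=
      hvmin n hxZ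
    have := habs x hxZ (v n) (hvZ n)
    simp at h1
    nlinarith
  have hv : Tendsto v atTop (𝓝 x) := by
    rw [tendsto_iff_norm_sub_tendsto_zero]
    have h0 : Tendsto (fun n : ℕ => 4 * B / (n : ℝ)) atTop (𝓝 0) :=
      tendsto_const_div_atTop_nhds_zero_nat _
    have h1 : Tendsto (fun n => ‖v n - x‖ ^ 2) atTop (𝓝 0) := by
      refine squeeze_zero' (Eventually.of_forall fun n => by positivity) ?_ h0
      filter_upwards [eventually_gt_atTop 0] with n hn
      rw [le_div_iff₀ (by exact_mod_cast hn), mul_comm]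
      exact hdist n
    have h2 := (Real.continuous_sqrt.tendsto 0).comp h1
    simpa [Function.comp_def] using h2
  have hev : ∀ᶠ n in atTop, ‖v n - x‖ ≤ r / 2 :=
    ((tendsto_iff_norm_sub_tendsto_zero.1 hv).eventually (Iic_mem_nhds (half_pos hr)))
  obtain ⟨n₀, hn₀⟩ := eventually_atTop.1 hev
  have hbound : ∀ n, (((n + n₀ : ℕ) : ℝ) • (x - v (n + n₀))) ∈
      Metric.closedBall (0 : E) (4 * B / r) := by
    intro n
    set g := ((n + n₀ : ℕ) : ℝ) • (x - v (n + n₀)) with hgdef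
    rw [mem_closedBall_zero_iff]
    have hB0 : 0 ≤ B := (norm_nonneg _).trans (hB x hxZ)
    rcases eq_or_ne g 0 with h0 | h0
    · rw [h0, norm_zero]
      positivity
    have hgpos : 0 < ‖g‖ := norm_pos_iff.2 h0
    have hgD : g ∈ (affineSpan ℝ Z).direction :=
      Submodule.smul_mem _ _ (sub_mem_direction hxZ (hvZ _))
    have hnn : ‖(r / 2 * ‖g‖⁻¹) • g‖ = r / 2 := by
      rw [norm_smul, norm_mul, norm_inv, norm_norm, Real.norm_of_nonneg (by positivity)]
      field_simp
    -- As `v` is within `r / 2` of `x`, a move of length `r / 2` along `g` stays in `Z`. The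
    -- subgradient inequality there reads `r / 2 * ‖g‖ ≤ 2 * B`.
    have hu : v (n + n₀) + (r / 2 * ‖g‖⁻¹) • g ∈ Z := by
      have := hball ((v (n + n₀) - x) + (r / 2 * ‖g‖⁻¹) • g)
        (Submodule.add_mem _ (sub_mem_direction (hvZ _) hxZ) (Submodule.smul_mem _ _ hgD))
        ((norm_add_le _ _).trans (by rw [hnn]; linarith [hn₀ (n + n₀) (Nat.le_add_left _ _)]))
      rwa [← add_assoc, add_sub_cancel] at this
    have h1 := hg (n + n₀) _ hu
    rw [add_sub_cancel_left, ← hgdef, inner_smul_right, real_inner_self_eq_norm_sq] at h1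
    have h2 := habs _ hu _ (hvZ (n + n₀))
    have h3 : r / 2 * ‖g‖⁻¹ * ‖g‖ ^ 2 = r / 2 * ‖g‖ := by field_simp
    rw [le_div_iff₀ hr]
    nlinarith
  obtain ⟨g, -, φ, hφ, hlim⟩ := tendsto_subseq_of_bounded Metric.isBounded_closedBall hbound
  have hv' : Tendsto (fun k => v (φ k + n₀)) atTop (𝓝 x) :=
    hv.comp ((tendsto_add_atTop_nat n₀).comp hφ.tendsto_atTop)
  have hωv : Tendsto (fun k => ω (v (φ k + n₀))) atTop (𝓝 (ω x)) :=
    (hc x hxZ).tendsto.comp (tendsto_nhdsWithin_iff.2 ⟨hv', Eventually.of_forall fun _ => hvZ _⟩)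
  refine ⟨g, fun u hu => le_of_tendsto
    (hωv.add (hlim.inner (tendsto_const_nhds.sub hv'))) (Eventually.of_forall fun k => ?_)⟩
  exact hg (φ k + n₀) u hu

end RelativeInterior

/-! ### The prox-function and the prox-mapping. -/

section Prox

theorem argminOn_spec {E : Type*} [NormedAddCommGroup E] {Z : Set E} {f : E → ℝ}
    (hZ : IsCompact Z) (hne : Z.Nonempty) (hf : ContinuousOn f Z) :
    argminOn f Z ∈ Z ∧ IsMinOn f Z (argminOn f Z) :=
  Classical.epsilon_spec (p := fun z => z ∈ Z ∧ IsMinOn f Z z) (hZ.exists_isMinOn hne hf)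

variable {E : Type*} [NormedAddCommGroup E] [InnerProductSpace ℝ E]
  {p : Seminorm ℝ E} {Z : Set E} {ω : E → ℝ} {ω' : E → E} {α : ℝ}

theorem proxFun_continuousOn (hω : ContinuousOn ω Z) (z : E) :
    ContinuousOn (proxFun ω ω' z) Z := by
  unfold proxFun
  fun_prop

theorem proxFun_self (z : E) : proxFun ω ω' z z = 0 := by
  simp [proxFun]

theorem center_mem (hZ : IsCompact Z) (hne : Z.Nonempty) (hω : ContinuousOn ω Z) :
    center Z ω ∈ subdiffDomain Z ω := by
  obtain ⟨h1, h2⟩ := argminOn_spec hZ hne hω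
  exact ⟨h1, 0, fun u hu => by simpa [center] using h2 hu⟩

theorem prox_mem_and_subdiff (hZ : IsCompact Z) (hne : Z.Nonempty) (hω : ContinuousOn ω Z)
    (z ξ : E) : prox Z ω ω' z ξ ∈ Z ∧ ω' z - ξ ∈ subdiff Z ω (prox Z ω ω' z ξ) := by
  have hf : ContinuousOn (fun u => proxFun ω ω' z u + ⟪ξ, u⟫) Z :=
    (proxFun_continuousOn hω z).add (by fun_prop)
  obtain ⟨h1, h2⟩ := argminOn_spec hZ hne hf
  refine ⟨h1, fun u hu => ?_⟩
  have h3 := h2 hu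
  change proxFun ω ω' z (prox Z ω ω' z ξ) + ⟪ξ, prox Z ω ω' z ξ⟫ ≤ proxFun ω ω' z u + ⟪ξ, u⟫ at h3
  simp only [proxFun, inner_sub_left, inner_sub_right] at h3 ⊢
  linarith

theorem prox_mem (hZ : IsCompact Z) (hne : Z.Nonempty) (hω : ContinuousOn ω Z) (z ξ : E) :
    prox Z ω ω' z ξ ∈ subdiffDomain Z ω :=
  ⟨(prox_mem_and_subdiff hZ hne hω z ξ).1, _, (prox_mem_and_subdiff hZ hne hω z ξ).2⟩

theorem proxFun_le_Theta (hZ : IsCompact Z) (hω : ContinuousOn ω Z) (z : E) {u : E} (hu : u ∈ Z) :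
    proxFun ω ω' z u ≤ Theta Z ω ω' z := by
  obtain ⟨B, hB⟩ := hZ.exists_bound_of_continuousOn (proxFun_continuousOn (ω' := ω') hω z)
  refine le_ciSup (f := fun u : Z => proxFun ω ω' z u) ⟨B, ?_⟩ ⟨u, hu⟩
  rintro _ ⟨v, rfl⟩
  exact (le_abs_self _).trans (hB v v.2)

theorem Theta_center_nonneg (hZ : IsCompact Z) (hne : Z.Nonempty) (hω : ContinuousOn ω Z) :
    0 ≤ Theta Z ω ω' (center Z ω) := by
  have := proxFun_le_Theta (ω' := ω') hZ hω (center Z ω) (center_mem hZ hne hω).1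
  rwa [proxFun_self] at this

theorem IsDistGen.Omega_sq (hω : IsDistGen p Z ω ω' α) (hZ : IsCompact Z) (hne : Z.Nonempty) :
    α * Omega Z ω ω' α ^ 2 = 2 * Theta Z ω ω' (center Z ω) := by
  have hα := hω.modulus_pos
  rw [Omega, Real.sq_sqrt (div_nonneg (by
    linarith [Theta_center_nonneg (ω' := ω') hZ hne hω.continuousOn]) hα.le)]
  field_simp

variable [FiniteDimensional ℝ E]

/-- Extending a closed condition from the relative interior of `Z` to `Z`. -/
theorem forall_mem_of_relInterior (hZc : Convex ℝ Z) {f g : E → ℝ}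
    (hf : ContinuousOn f Z) (hg : ContinuousOn g Z)
    (h : ∀ u ∈ relInterior Z, f u ≤ g u) : ∀ u ∈ Z, f u ≤ g u := by
  intro u hu
  obtain ⟨q, hq⟩ := relInterior_nonempty hZc ⟨u, hu⟩
  have hlim : Tendsto (fun s : ℝ => u + s • (q - u)) (𝓝[>] 0) (𝓝[Z] u) := by
    refine tendsto_nhdsWithin_iff.2 ⟨?_, ?_⟩
    · have : Continuous fun s : ℝ => u + s • (q - u) := by fun_prop
      simpa using (this.tendsto 0).mono_left nhdsWithin_le_nhds
    · filter_upwards [Ioo_mem_nhdsGT (zero_lt_one' ℝ)] with s hs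
      exact relInterior_subset Z (relInterior_segment hZc hu hq hs.1 hs.2.le)
  refine le_of_tendsto_of_tendsto ((hf u hu).tendsto.comp hlim) ((hg u hu).tendsto.comp hlim) ?_
  filter_upwards [Ioo_mem_nhdsGT (zero_lt_one' ℝ)] with s hs
  exact h _ (relInterior_segment hZc hu hq hs.1 hs.2.le)

namespace IsDistGen

variable (hω : IsDistGen p Z ω ω' α) (hZ : IsCompact Z)
include hω hZ

theorem segment_mem {z q : E} (hz : z ∈ subdiffDomain Z ω) (hq : q ∈ relInterior Z) {s : ℝ}
    (hs : 0 ≤ s) (hs1 : s ≤ 1) : z + s • (q - z) ∈ subdiffDomain Z ω := by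
  rcases hs.eq_or_lt with rfl | hs
  · simpa using hz
  · exact relInterior_subset_subdiffDomain hZ hω.continuousOn hω.convexOn
      (relInterior_segment hω.convexOn.1 hz.1 hq hs hs1)

/-- The selection `ω'` is minimal among the subgradients in all feasible directions. -/
theorem inner_selection_sub_nonneg {z g : E} (hz : z ∈ Z) (hg : g ∈ subdiff Z ω z) {u : E}
    (hu : u ∈ Z) : 0 ≤ ⟪ω' z - g, u - z⟫ := by
  have hz' : z ∈ subdiffDomain Z ω := ⟨hz, g, hg⟩
  refine forall_mem_of_relInterior hω.convexOn.1 (f := fun _ => 0)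
    (g := fun u => ⟪ω' z - g, u - z⟫) (by fun_prop) (by fun_prop) (fun q hq => ?_) u hu
  -- Monotonicity of the subdifferential gives `⟪ω'(z + s(q - z)) - g, q - z⟫ ≥ 0` for each `s > 0`.
  -- The segment lies in `Z^o`, so continuity of `ω'` transfers this to `s = 0`.
  have hlim : Tendsto (fun s : ℝ => z + s • (q - z)) (𝓝[>] 0) (𝓝[subdiffDomain Z ω] z) := by
    refine tendsto_nhdsWithin_iff.2 ⟨?_, ?_⟩
    · have : Continuous fun s : ℝ => z + s • (q - z) := by fun_prop
      simpa using (this.tendsto 0).mono_left nhdsWithin_le_nhds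
    · filter_upwards [Ioo_mem_nhdsGT (zero_lt_one' ℝ)] with s hs
      exact hω.segment_mem hZ hz' hq hs.1.le hs.2.le
  have hlim' := (hω.selection_continuousOn z hz').tendsto.comp hlim
  refine ge_of_tendsto ((hlim'.sub (tendsto_const_nhds (x := g))).inner
    (tendsto_const_nhds (x := q - z))) ?_
  filter_upwards [Ioo_mem_nhdsGT (zero_lt_one' ℝ)] with s hs
  have hs' := hω.segment_mem hZ hz' hq hs.1.le hs.2.le
  have h1 := hω.selection _ hs' z hz
  have h2 := hg _ hs'.1
  rw [add_sub_cancel_left, inner_smul_right] at h2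
  rw [sub_add_cancel_left, inner_neg_right, inner_smul_right] at h1
  simp only [Function.comp_apply, inner_sub_left]
  nlinarith [hs.1]

/-- The prox-function is bounded below by the squared distance. -/
theorem le_proxFun {z u : E} (hz : z ∈ subdiffDomain Z ω) (hu : u ∈ Z) :
    α / 2 * p (u - z) ^ 2 ≤ proxFun ω ω' z u := by
  have hpc := seminorm_continuous p
  refine forall_mem_of_relInterior hω.convexOn.1 (f := fun u => α / 2 * p (u - z) ^ 2)
    (by fun_prop) (proxFun_continuousOn hω.continuousOn z) (fun q hq => ?_) u hu
  set d := q - z with hd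
  have hmem : ∀ s ∈ Icc (0 : ℝ) 1, z + s • d ∈ subdiffDomain Z ω :=
    fun s hs => hω.segment_mem hZ hz hq hs.1 hs.2
  have hmono : ∀ s ∈ Icc (0 : ℝ) 1, ⟪ω' z, d⟫ + α * s * p d ^ 2 ≤ ⟪ω' (z + s • d), d⟫ := by
    intro s hs
    rcases hs.1.eq_or_lt with rfl | hs0
    · simp
    have h := hω.strong _ (hmem s hs) z hz
    rw [add_sub_cancel_left, inner_smul_right, map_smul_eq_mul, Real.norm_of_nonneg hs.1,
      inner_sub_left] at h
    refine le_of_mul_le_mul_left ?_ hs0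
    nlinarith
  have hstep : ∀ s ∈ Icc (0 : ℝ) 1, ∀ h, s + h ∈ Icc (0 : ℝ) 1 → 0 ≤ h →
      ω (z + s • d) + h * (⟪ω' z, d⟫ + α * s * p d ^ 2) ≤ ω (z + (s + h) • d) := by
    intro s hs h hsh hh
    have h1 := hω.selection _ (hmem s hs) _ (hmem _ hsh).1
    rw [show z + (s + h) • d - (z + s • d) = h • d by module, inner_smul_right] at h1
    nlinarith [hmono s hs]
  -- A Riemann sum in place of integrating the derivative of `ω` along the segment: `k` subgradient
  -- inequalities of step `1 / n` at left endpoints, with `∑_{j<k} j / n² = k(k - 1) / (2n²)`. For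
  -- `k = n → ∞` this tends to `1 / 2`.
  have hsum : ∀ n : ℕ, 0 < n → ∀ k : ℕ, k ≤ n →
      ω z + (k / n : ℝ) * ⟪ω' z, d⟫ + α * p d ^ 2 * (k * (k - 1) / (2 * n ^ 2)) ≤
        ω (z + (k / n : ℝ) • d) := by
    intro n hn k
    have hn' : (0 : ℝ) < n := by exact_mod_cast hn
    induction k with
    | zero => simp
    | succ k ih =>
      intro hk
      have hk' : (k : ℝ) + 1 ≤ n := by exact_mod_cast hk
      have h1 := ih (by omega)
      have h2 := hstep (k / n) ⟨by positivity, (div_le_one hn').2 (by linarith)⟩ (1 / n)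
        (by rw [← add_div]; exact ⟨by positivity, (div_le_one hn').2 hk'⟩) (by positivity)
      rw [← add_div] at h2
      push_cast
      refine le_trans (le_of_eq ?_) ((add_le_add_left h1 _).trans h2)
      field_simp
      ring
  have hlim : Tendsto (fun n : ℕ => ω z + ⟪ω' z, d⟫ + α * p d ^ 2 * (1 / 2 - 1 / 2 * (1 / (n : ℝ))))
      atTop (𝓝 (ω z + ⟪ω' z, d⟫ + α * p d ^ 2 * (1 / 2 - 1 / 2 * 0))) :=
    ((tendsto_one_div_atTop_nhds_zero_nat.const_mul _).const_sub _).const_mul _ |>.const_add _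
  have := le_of_tendsto hlim (b := ω q) (by
    filter_upwards [eventually_gt_atTop 0] with n hn
    have hn' : (0 : ℝ) < n := by exact_mod_cast hn
    have h := hsum n hn n le_rfl
    rw [div_self hn'.ne', one_smul, hd, add_sub_cancel, ← hd] at h
    refine le_trans (le_of_eq ?_) h
    field_simp)
  simp only [proxFun]
  linarith

theorem proxFun_nonneg {z u : E} (hz : z ∈ subdiffDomain Z ω) (hu : u ∈ Z) :
    0 ≤ proxFun ω ω' z u :=
  le_trans (mul_nonneg (half_pos hω.modulus_pos).le (sq_nonneg _)) (hω.le_proxFun hZ hz hu)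

/-- Minimality makes `ω' z - ξ` a subgradient at the prox point, and by `inner_selection_sub_nonneg`
it may be replaced by the selected subgradient there; the rest is the three-point identity for `V`.
-/
theorem inner_prox_sub_le {z ξ u : E} (hu : u ∈ Z) :
    ⟪ξ, prox Z ω ω' z ξ - u⟫ ≤ proxFun ω ω' z u - proxFun ω ω' (prox Z ω ω' z ξ) u -
      proxFun ω ω' z (prox Z ω ω' z ξ) := by
  obtain ⟨h1, h2⟩ := prox_mem_and_subdiff (ω' := ω') hZ ⟨u, hu⟩ hω.continuousOn z ξ
  have h3 := hω.inner_selection_sub_nonneg hZ h1 h2 hu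
  simp only [proxFun, inner_sub_left, inner_sub_right] at h3 ⊢
  linarith

theorem dist_center_le {u : E} (hu : u ∈ Z) : p (u - center Z ω) ≤ Omega Z ω ω' α := by
  have hα := hω.modulus_pos
  refine Real.le_sqrt_of_sq_le ?_
  rw [le_div_iff₀ hα]
  have h1 := hω.le_proxFun hZ (center_mem hZ ⟨u, hu⟩ hω.continuousOn) hu
  have h2 := proxFun_le_Theta (ω' := ω') hZ hω.continuousOn (center Z ω) hu
  linarith

theorem dist_le {u v : E} (hu : u ∈ Z) (hv : v ∈ Z) : p (u - v) ≤ 2 * Omega Z ω ω' α := by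
  have h := map_sub_le_add p (u - center Z ω) (v - center Z ω)
  rw [sub_sub_sub_cancel_right] at h
  linarith [hω.dist_center_le hZ hu, hω.dist_center_le hZ hv]

/-- The optimality conditions at the two prox points are added to the strong monotonicity of `ω'`.
This yields continuity of the prox-mapping, and thus measurability of the iterates. -/
theorem dist_prox_le (hp : ∀ x, p x = 0 → x = 0) (hne : Z.Nonempty) (z₁ ξ₁ z₂ ξ₂ : E) :
    α * p (prox Z ω ω' z₁ ξ₁ - prox Z ω ω' z₂ ξ₂) ≤
      conjNorm p ((ω' z₁ - ξ₁) - (ω' z₂ - ξ₂)) := by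
  obtain ⟨h1, h1'⟩ := prox_mem_and_subdiff (ω' := ω') hZ hne hω.continuousOn z₁ ξ₁
  obtain ⟨h2, h2'⟩ := prox_mem_and_subdiff (ω' := ω') hZ hne hω.continuousOn z₂ ξ₂
  set x₁ := prox Z ω ω' z₁ ξ₁
  set x₂ := prox Z ω ω' z₂ ξ₂
  have h3 := hω.inner_selection_sub_nonneg hZ h1 h1' h2
  have h4 := hω.inner_selection_sub_nonneg hZ h2 h2' h1
  have h5 := hω.strong _ ⟨h1, _, h1'⟩ _ ⟨h2, _, h2'⟩
  have h6 := inner_le_conjNorm hp ((ω' z₁ - ξ₁) - (ω' z₂ - ξ₂)) (x₁ - x₂)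
  rw [← neg_sub x₁ x₂, inner_neg_right] at h3
  rw [inner_sub_left] at h3 h4 h5 h6
  rcases (apply_nonneg p (x₁ - x₂)).eq_or_lt with h0 | h0
  · rw [← h0, mul_zero]
    exact conjNorm_nonneg hp _
  · refine le_of_mul_le_mul_right ?_ h0
    rw [sq] at h5
    linarith

end IsDistGen

end Prox

/-! ### Pathwise regret bound for Mirror-Prox. -/

section Regret

variable {E : Type*} [NormedAddCommGroup E] [InnerProductSpace ℝ E]
  {p : Seminorm ℝ E} {Z : Set E} {ω : E → ℝ} {ω' : E → E} {α : ℝ}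

section Sequence

variable {S : Type*}

/-- The auxiliary sequence of prox-steps along the oracle errors at the intermediate points. -/
noncomputable def smpAux (Z : Set E) (ω : E → ℝ) (ω' : E → E) (F : E → E) (Ξ : E → S → E)
    (r₀ : E) (γ : ℕ → ℝ) (s : ℕ → S) : ℕ → E
  | 0 => r₀
  | τ + 1 => prox Z ω ω' (smpAux Z ω ω' F Ξ r₀ γ s τ)
      (-(γ τ • (Ξ (smpW Z ω ω' Ξ r₀ γ s τ) (s (2 * τ + 1)) - F (smpW Z ω ω' Ξ r₀ γ s τ))))

variable (hω : ContinuousOn ω Z) (hZ : IsCompact Z) (Ξ : E → S → E) {r₀ : E}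
  (hr₀ : r₀ ∈ subdiffDomain Z ω) (γ : ℕ → ℝ) (s : ℕ → S) (τ : ℕ)
include hω hZ hr₀

theorem smpR_mem : smpR Z ω ω' Ξ r₀ γ s τ ∈ subdiffDomain Z ω := by
  cases τ with
  | zero => exact hr₀
  | succ τ => exact prox_mem hZ ⟨_, hr₀.1⟩ hω _ _

theorem smpW_mem : smpW Z ω ω' Ξ r₀ γ s τ ∈ subdiffDomain Z ω :=
  prox_mem hZ ⟨_, hr₀.1⟩ hω _ _

theorem smpAux_mem (F : E → E) : smpAux Z ω ω' F Ξ r₀ γ s τ ∈ subdiffDomain Z ω := by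
  cases τ with
  | zero => exact hr₀
  | succ τ => exact prox_mem hZ ⟨_, hr₀.1⟩ hω _ _

end Sequence

variable [FiniteDimensional ℝ E]

theorem mul_sub_half_mul_sq_le (hα : 0 < α) (a x : ℝ) :
    a * x - α / 2 * x ^ 2 ≤ a ^ 2 / (2 * α) := by
  rw [le_div_iff₀ (by positivity)]
  nlinarith [sq_nonneg (a - α * x)]

namespace IsDistGen

variable (hω : IsDistGen p Z ω ω' α) (hZ : IsCompact Z) (hp : ∀ x, p x = 0 → x = 0)
include hω hZ hp

/-- The mirror-descent estimate: moving from `y` to the prox point costs `⟪ξ, y - P⟫`, which Young's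
inequality pays for with the term `-V(y, P) ≤ -α/2 · p(y - P)²`. -/
theorem inner_sub_le_of_prox {y ξ u : E} (hy : y ∈ subdiffDomain Z ω) (hu : u ∈ Z) :
    ⟪ξ, y - u⟫ ≤ proxFun ω ω' y u - proxFun ω ω' (prox Z ω ω' y ξ) u +
      conjNorm p ξ ^ 2 / (2 * α) := by
  have h1 := hω.inner_prox_sub_le hZ (z := y) (ξ := ξ) hu
  have hmem := prox_mem (ω' := ω') hZ ⟨u, hu⟩ hω.continuousOn y ξ
  have h2 := hω.le_proxFun hZ hy hmem.1
  have h3 := inner_le_conjNorm hp ξ (y - prox Z ω ω' y ξ)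
  have h4 := mul_sub_half_mul_sq_le hω.modulus_pos (conjNorm p ξ) (p (y - prox Z ω ω' y ξ))
  rw [map_sub_rev p] at h2
  have h5 : ⟪ξ, y - u⟫ = ⟪ξ, y - prox Z ω ω' y ξ⟫ + ⟪ξ, prox Z ω ω' y ξ - u⟫ := by
    rw [← inner_add_right, sub_add_sub_cancel]
  linarith

/-- The extragradient estimate. In `⟪ξ, w - u⟫ = ⟪ξ, r' - u⟫ + ⟪η, w - r'⟫ + ⟪ξ - η, w - r'⟫` the
prox inequality is used twice, with target `u` and with target `r'`, so that `V(r, r')` cancels. Of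
the remaining terms, `-V(w, r')` absorbs the last product and `-V(r, w)` is kept. -/
theorem inner_halfStep_sub_le {r η ξ u : E} (hr : r ∈ subdiffDomain Z ω) (hu : u ∈ Z) :
    ⟪ξ, prox Z ω ω' r η - u⟫ ≤ proxFun ω ω' r u - proxFun ω ω' (prox Z ω ω' r ξ) u +
      conjNorm p (ξ - η) ^ 2 / (2 * α) - α / 2 * p (prox Z ω ω' r η - r) ^ 2 := by
  have hw := prox_mem (ω' := ω') hZ ⟨u, hu⟩ hω.continuousOn r η
  have hr' := prox_mem (ω' := ω') hZ ⟨u, hu⟩ hω.continuousOn r ξ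
  have h1 := hω.inner_prox_sub_le hZ (z := r) (ξ := ξ) hu
  have h2 := hω.inner_prox_sub_le hZ (z := r) (ξ := η) hr'.1
  set w := prox Z ω ω' r η
  set r' := prox Z ω ω' r ξ
  have h3 := hω.le_proxFun hZ hr hw.1
  have h4 := hω.le_proxFun hZ hw hr'.1
  have h5 := inner_le_conjNorm hp (ξ - η) (w - r')
  have h6 := mul_sub_half_mul_sq_le hω.modulus_pos (conjNorm p (ξ - η)) (p (w - r'))
  rw [map_sub_rev p] at h4
  have h7 : ⟪ξ, w - u⟫ = ⟪ξ, r' - u⟫ + ⟪η, w - r'⟫ + ⟪ξ - η, w - r'⟫ := by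
    simp only [inner_sub_left, inner_sub_right]
    ring
  linarith

end IsDistGen

theorem conjNorm_smul {γ : ℝ} (hp : ∀ x, p x = 0 → x = 0) (hγ : 0 ≤ γ) (ξ : E) :
    conjNorm p (γ • ξ) ≤ γ * conjNorm p ξ :=
  conjNorm_le fun z hz => by
    rw [real_inner_smul_left]
    exact mul_le_mul_of_nonneg_left (inner_le_conjNorm_of_le_one hp ξ hz) hγ

/-- The squared difference of two oracle values in terms of the oracle errors. -/
theorem conjNorm_sub_sq_le (hp : ∀ x, p x = 0 → x = 0) {L M : ℝ} {w r ξ η Fw Fr : E}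
    (hF : conjNorm p (Fw - Fr) ≤ L * p (w - r) + M) :
    conjNorm p (ξ - η) ^ 2 ≤ 3 * L ^ 2 * p (w - r) ^ 2 +
      (3 * M ^ 2 + 6 * conjNorm p (η - Fr) ^ 2 + 6 * conjNorm p (ξ - Fw) ^ 2) := by
  have h1 : conjNorm p (ξ - η) ≤
      L * p (w - r) + M + conjNorm p (η - Fr) + conjNorm p (ξ - Fw) := by
    have e : ξ - η = (Fw - Fr) + ((ξ - Fw) - (η - Fr)) := by abel
    have h2 := conjNorm_add_le hp (Fw - Fr) ((ξ - Fw) - (η - Fr))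
    have h3 := conjNorm_sub_le hp (ξ - Fw) (η - Fr)
    rw [e]
    linarith
  have h0 := conjNorm_nonneg hp (ξ - η)
  set a := conjNorm p (η - Fr)
  set b := conjNorm p (ξ - Fw)
  set x := L * p (w - r)
  have h2 : conjNorm p (ξ - η) ^ 2 ≤ (x + M + a + b) ^ 2 := pow_le_pow_left₀ h0 h1 2
  have h3 : L ^ 2 * p (w - r) ^ 2 = x ^ 2 := (mul_pow _ _ _).symm
  -- `(x + M + (a + b))² ≤ 3x² + 3M² + 3(a + b)²` and `(a + b)² ≤ 2a² + 2b²`.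
  nlinarith [sq_nonneg (x - M), sq_nonneg (x - (a + b)), sq_nonneg (M - (a + b)),
    sq_nonneg (a - b)]

/-- The bound for one step of the algorithm, with the auxiliary sequence that tracks the oracle
errors at the intermediate points. -/
theorem step_le (hω : IsDistGen p Z ω ω' α) (hZ : IsCompact Z) (hp : ∀ x, p x = 0 → x = 0)
    {F : E → E} {L M γ : ℝ} (hL : 0 ≤ L)
    (hF : ∀ z ∈ Z, ∀ z' ∈ Z, conjNorm p (F z - F z') ≤ L * p (z - z') + M)
    (hγ : 0 < γ) (hγL : √3 * L * γ ≤ α) {r y w η ξ u : E} (hr : r ∈ subdiffDomain Z ω)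
    (hy : y ∈ subdiffDomain Z ω) (hu : u ∈ Z) (hw : w = prox Z ω ω' r (γ • η)) :
    γ * ⟪F w, w - u⟫ ≤ (proxFun ω ω' r u + proxFun ω ω' y u) -
      (proxFun ω ω' (prox Z ω ω' r (γ • ξ)) u +
        proxFun ω ω' (prox Z ω ω' y (-(γ • (ξ - F w)))) u) +
      γ ^ 2 / (2 * α) * (3 * M ^ 2 + 6 * conjNorm p (η - F r) ^ 2 +
        7 * conjNorm p (ξ - F w) ^ 2) + γ * ⟪ξ - F w, y - w⟫ := by
  have hα := hω.modulus_pos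
  have hwZ : w ∈ Z := hw ▸ (prox_mem (ω' := ω') hZ ⟨u, hu⟩ hω.continuousOn r (γ • η)).1
  have h1 := hω.inner_halfStep_sub_le hZ hp (η := γ • η) (ξ := γ • ξ) hr hu
  rw [← hw, ← smul_sub, real_inner_smul_left] at h1
  -- The auxiliary step adds one more squared error at `w`, raising its coefficient from 6 to 7.
  have h2 := hω.inner_sub_le_of_prox hZ hp (ξ := -(γ • (ξ - F w))) hy hu
  rw [conjNorm_neg, inner_neg_left, real_inner_smul_left] at h2
  have sq_le : ∀ ξ : E, conjNorm p (γ • ξ) ^ 2 / (2 * α) ≤ γ ^ 2 / (2 * α) * conjNorm p ξ ^ 2 := by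
    intro ξ
    rw [div_mul_eq_mul_div, ← mul_pow]
    gcongr
    · exact conjNorm_nonneg hp _
    · exact conjNorm_smul hp hγ.le ξ
  have h3 := sq_le (ξ - η)
  have h4 := sq_le (ξ - F w)
  have h5 := mul_le_mul_of_nonneg_left
    (conjNorm_sub_sq_le hp (ξ := ξ) (η := η) (hF w hwZ r hr.1))
    (show 0 ≤ γ ^ 2 / (2 * α) by positivity)
  -- The stepsize condition, squared, is `3L²γ² ≤ α²`: exactly what cancels the Lipschitz term.
  have h6 : γ ^ 2 / (2 * α) * (3 * L ^ 2 * p (w - r) ^ 2) ≤ α / 2 * p (w - r) ^ 2 := by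
    rw [← mul_assoc]
    gcongr
    rw [div_mul_eq_mul_div, div_le_div_iff₀ (by positivity) (by positivity)]
    have h7 : (√3 * L * γ) ^ 2 ≤ α ^ 2 := pow_le_pow_left₀ (by positivity) hγL 2
    rw [mul_pow, mul_pow, Real.sq_sqrt (by norm_num)] at h7
    nlinarith
  have h8 : ⟪ξ, w - u⟫ = ⟪F w, w - u⟫ + ⟪ξ - F w, y - u⟫ - ⟪ξ - F w, y - w⟫ := by
    simp only [inner_sub_left, inner_sub_right]
    ring
  rw [h8] at h1
  nlinarith

/-- The regret of the intermediate points. -/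
theorem sum_inner_le {S : Type*} (hω : IsDistGen p Z ω ω' α) (hZ : IsCompact Z)
    (hp : ∀ x, p x = 0 → x = 0) {F : E → E} {L M γ : ℝ} (hL : 0 ≤ L)
    (hF : ∀ z ∈ Z, ∀ z' ∈ Z, conjNorm p (F z - F z') ≤ L * p (z - z') + M)
    (hγ : 0 < γ) (hγL : √3 * L * γ ≤ α) (Ξ : E → S → E) (s : ℕ → S) {r w y : ℕ → E}
    (hr : r = smpR Z ω ω' Ξ (center Z ω) (fun _ => γ) s)
    (hw : w = smpW Z ω ω' Ξ (center Z ω) (fun _ => γ) s)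
    (hy : y = smpAux Z ω ω' F Ξ (center Z ω) (fun _ => γ) s) (t : ℕ) {u : E} (hu : u ∈ Z) :
    γ * ∑ τ ∈ Finset.range t, ⟪F (w τ), w τ - u⟫ ≤ α * Omega Z ω ω' α ^ 2 +
      γ ^ 2 / (2 * α) * ∑ τ ∈ Finset.range t,
        (3 * M ^ 2 + 6 * conjNorm p (Ξ (r τ) (s (2 * τ)) - F (r τ)) ^ 2 +
          7 * conjNorm p (Ξ (w τ) (s (2 * τ + 1)) - F (w τ)) ^ 2) +
      γ * ∑ τ ∈ Finset.range t, ⟪Ξ (w τ) (s (2 * τ + 1)) - F (w τ), y τ - w τ⟫ := by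
  have hne : Z.Nonempty := ⟨u, hu⟩
  have hc := center_mem hZ hne hω.continuousOn
  have hrmem : ∀ τ, r τ ∈ subdiffDomain Z ω := fun τ =>
    hr ▸ smpR_mem hω.continuousOn hZ Ξ hc _ s τ
  have hymem : ∀ τ, y τ ∈ subdiffDomain Z ω := fun τ =>
    hy ▸ smpAux_mem hω.continuousOn hZ Ξ hc _ s τ F
  have hr' : ∀ τ, r (τ + 1) = prox Z ω ω' (r τ) (γ • Ξ (w τ) (s (2 * τ + 1))) := fun τ => by
    rw [hr, hw]; rfl
  have hw' : ∀ τ, w τ = prox Z ω ω' (r τ) (γ • Ξ (r τ) (s (2 * τ))) := fun τ => by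
    rw [hr, hw]; rfl
  have hy' : ∀ τ, y (τ + 1) = prox Z ω ω' (y τ)
      (-(γ • (Ξ (w τ) (s (2 * τ + 1)) - F (w τ)))) := fun τ => by
    rw [hy, hw]; rfl
  have key : γ * ∑ τ ∈ Finset.range t, ⟪F (w τ), w τ - u⟫ ≤
      (2 * Theta Z ω ω' (center Z ω) - (proxFun ω ω' (r t) u + proxFun ω ω' (y t) u)) +
      γ ^ 2 / (2 * α) * ∑ τ ∈ Finset.range t,
        (3 * M ^ 2 + 6 * conjNorm p (Ξ (r τ) (s (2 * τ)) - F (r τ)) ^ 2 +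
          7 * conjNorm p (Ξ (w τ) (s (2 * τ + 1)) - F (w τ)) ^ 2) +
      γ * ∑ τ ∈ Finset.range t, ⟪Ξ (w τ) (s (2 * τ + 1)) - F (w τ), y τ - w τ⟫ := by
    induction t with
    | zero =>
      have h0 := proxFun_le_Theta (ω' := ω') hZ hω.continuousOn (center Z ω) hu
      have h1 : r 0 = center Z ω := by rw [hr]; rfl
      have h2 : y 0 = center Z ω := by rw [hy]; rfl
      simp only [Finset.range_zero, Finset.sum_empty, h1, h2]
      linarith
    | succ t ih =>
      have h1 := step_le hω hZ hp hL hF hγ hγL (ξ := Ξ (w t) (s (2 * t + 1)))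
        (hrmem t) (hymem t) hu (hw' t)
      rw [← hr' t, ← hy' t] at h1
      simp only [Finset.sum_range_succ, mul_add] at ih ⊢
      linarith
  have h1 := hω.proxFun_nonneg hZ (hrmem t) hu
  have h2 := hω.proxFun_nonneg hZ (hymem t) hu
  rw [hω.Omega_sq hZ hne]
  linarith

end Regret

theorem smpOutput_const {E S : Type*} [NormedAddCommGroup E] [InnerProductSpace ℝ E] (Z : Set E)
    (ω : E → ℝ) (ω' : E → E) (Ξ : E → S → E) (r₀ : E) {γ : ℝ} (hγ : γ ≠ 0) (s : ℕ → S) (t : ℕ) :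
    smpOutput Z ω ω' Ξ r₀ (fun _ => γ) s t =
      ∑ τ ∈ Finset.range t, (t : ℝ)⁻¹ • smpW Z ω ω' Ξ r₀ (fun _ => γ) s τ := by
  rw [smpOutput, ← Finset.smul_sum, ← Finset.smul_sum, smul_smul]
  congr 1
  rw [Finset.sum_const, Finset.card_range, nsmul_eq_mul]
  field_simp

/-! ### From regret to the v.i. error. -/

section Gap

variable {E : Type*} [NormedAddCommGroup E] [InnerProductSpace ℝ E]
  {p : Seminorm ℝ E} {Z : Set E} {F : E → E}

/-- Monotonicity gives `⟪F u, w τ - u⟫ ≤ ⟪F (w τ), w τ - u⟫`, and the left side is affine in `w τ`,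
so it passes to the average. -/
theorem errVI_average_le (hne : Z.Nonempty)
    (hFmono : ∀ z ∈ Z, ∀ z' ∈ Z, 0 ≤ ⟪F z - F z', z - z'⟫) {t : ℕ} (ht : 1 ≤ t) {w : ℕ → E}
    (hw : ∀ τ, w τ ∈ Z) {c : ℝ}
    (hc : ∀ u ∈ Z, ∑ τ ∈ Finset.range t, ⟪F (w τ), w τ - u⟫ ≤ t * c) :
    errVI Z F (∑ τ ∈ Finset.range t, (t : ℝ)⁻¹ • w τ) ≤ c := by
  have := hne.to_subtype
  have ht' : (0 : ℝ) < t := by exact_mod_cast ht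
  refine ciSup_le fun u => ?_
  have h1 : ∑ τ ∈ Finset.range t, (t : ℝ)⁻¹ • w τ - (u : E) =
      (t : ℝ)⁻¹ • ∑ τ ∈ Finset.range t, (w τ - u) := by
    rw [Finset.sum_sub_distrib, smul_sub, ← Finset.smul_sum, Finset.sum_const, Finset.card_range,
      ← Nat.cast_smul_eq_nsmul ℝ, smul_smul, inv_mul_cancel₀ ht'.ne', one_smul]
  rw [h1, inner_smul_right, inner_sum, inv_mul_le_iff₀ ht']
  refine le_trans (Finset.sum_le_sum fun τ _ => ?_) (hc u u.2)
  have := hFmono (w τ) (hw τ) u u.2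
  rw [inner_sub_left] at this
  linarith

/-- A finite supremum of affine functions with slopes bounded by `K` is `K`-Lipschitz. -/
theorem errVI_continuous (hne : Z.Nonempty) (hZ : IsCompact Z) {K : ℝ} (hK : 0 ≤ K)
    (hF : ∀ u ∈ Z, ‖F u‖ ≤ K) : Continuous (errVI Z F) := by
  have := hne.to_subtype
  refine (LipschitzWith.of_le_add_mul ⟨K, hK⟩ fun z z' => ?_).continuous
  obtain ⟨B, hB⟩ := hZ.isBounded.exists_norm_le
  have hbdd : BddAbove (range fun u : Z => ⟪F u, z' - (u : E)⟫) := by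
    refine ⟨K * (‖z'‖ + B), ?_⟩
    rintro _ ⟨u, rfl⟩
    refine (real_inner_le_norm _ _).trans ?_
    gcongr
    · exact hF u u.2
    · exact (norm_sub_le _ _).trans (by gcongr; exact hB u u.2)
  refine ciSup_le fun u => ?_
  have h1 : ⟪F u, z' - (u : E)⟫ ≤ errVI Z F z' := le_ciSup hbdd u
  have h2 : ⟪F u, z - z'⟫ ≤ K * dist z z' := by
    rw [dist_eq_norm]
    refine (real_inner_le_norm _ _).trans ?_
    gcongr
    exact hF u u.2
  rw [show z - (u : E) = (z' - u) + (z - z') by abel, inner_add_right]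
  exact add_le_add h1 h2

theorem exists_norm_operator_le [FiniteDimensional ℝ E] (hp : ∀ x, p x = 0 → x = 0)
    (hZ : IsCompact Z) {L M : ℝ} (hL : 0 ≤ L) (hF : ∀ z ∈ Z, ∀ z' ∈ Z, conjNorm p (F z - F z') ≤ L * p (z - z') + M) :
    ∃ K : ℝ, 0 ≤ K ∧ ∀ u ∈ Z, ‖F u‖ ≤ K := by
  rcases Z.eq_empty_or_nonempty with rfl | ⟨z, hz⟩
  · exact ⟨0, le_rfl, by simp⟩
  obtain ⟨C, hC, hC'⟩ := exists_norm_le_conjNorm hp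
  have hpc : ContinuousOn (fun u => p (u - z)) Z := by
    have := seminorm_continuous p
    fun_prop
  obtain ⟨B, hB⟩ := hZ.exists_bound_of_continuousOn hpc
  have h : ∀ u ∈ Z, ‖F u‖ ≤ C * (L * B + M) + ‖F z‖ := fun u hu => by
    have h1 : ‖F u - F z‖ ≤ C * (L * B + M) := (hC' _).trans (by
      gcongr
      refine (hF u hu z hz).trans ?_
      gcongr
      exact (le_abs_self _).trans (hB u hu))
    have := norm_le_norm_sub_add (F u) (F z)
    linarith
  exact ⟨_, (norm_nonneg _).trans (h z hz), h⟩

end Gap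

/-! ### From regret to the Nash error. -/

section Nash

variable {m : ℕ} {H : Fin m → Type*} {X : ∀ i, Set (H i)}

theorem deviate_mem {z : PiLp 2 H} (hz : z ∈ prodSet X) {i : Fin m} {x : H i} (hx : x ∈ X i) :
    deviate z i x ∈ prodSet X := by
  intro j
  rcases eq_or_ne j i with rfl | h
  · simpa [deviate] using hx
  · simpa [deviate, h] using hz j

theorem deviate_self (z : PiLp 2 H) (i : Fin m) : deviate z i (z i) = z := by
  simp [deviate]

variable [∀ i, NormedAddCommGroup (H i)]

theorem norm_deviate_sub_le (z z' : PiLp 2 H) (i : Fin m) (x : H i) :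
    ‖deviate z i x - deviate z' i x‖ ≤ ‖z - z'‖ := by
  rw [PiLp.norm_eq_of_L2, PiLp.norm_eq_of_L2]
  refine Real.sqrt_le_sqrt (Finset.sum_le_sum fun j _ => ?_)
  gcongr
  rcases eq_or_ne j i with rfl | h
  · simp [deviate]
  · simp [deviate, h]

theorem continuous_deviate (z : PiLp 2 H) (i : Fin m) : Continuous fun x => deviate z i x := by
  unfold deviate
  fun_prop

variable [∀ i, InnerProductSpace ℝ (H i)] {φ : Fin m → PiLp 2 H → ℝ}

theorem deviate_sum {t : ℕ} (ht : 1 ≤ t) (v : ℕ → PiLp 2 H) (i : Fin m) (x : H i) :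
    deviate (∑ τ ∈ Finset.range t, (t : ℝ)⁻¹ • v τ) i x =
      ∑ τ ∈ Finset.range t, (t : ℝ)⁻¹ • deviate (v τ) i x := by
  have ht' : (t : ℝ) ≠ 0 := by exact_mod_cast (by omega : t ≠ 0)
  ext j
  rcases eq_or_ne j i with rfl | h
  · simp [deviate, ← Nat.cast_smul_eq_nsmul ℝ, smul_smul, ht']
  · simp [deviate, h]

namespace IsConvexNash

variable (h : IsConvexNash X φ)
include h

theorem exists_iInf_eq {z : PiLp 2 H} (hz : z ∈ prodSet X) (i : Fin m) :
    ∃ x ∈ X i, ⨅ x : X i, φ i (deviate z i x) = φ i (deviate z i x) ∧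
      ∀ x' ∈ X i, φ i (deviate z i x) ≤ φ i (deviate z i x') := by
  obtain ⟨K, hK⟩ := h.lipschitz i
  have hc : ContinuousOn (fun x => φ i (deviate z i x)) (X i) :=
    hK.continuousOn.comp (continuous_deviate z i).continuousOn fun x hx => deviate_mem hz hx
  obtain ⟨x, hx, hmin⟩ := (h.isCompact i).exists_isMinOn ⟨_, hz i⟩ hc
  have : Nonempty (X i) := ⟨⟨x, hx⟩⟩
  refine ⟨x, hx, le_antisymm ?_ (le_ciInf fun x' => hmin x'.2), fun x' hx' => hmin hx'⟩
  exact ciInf_le ⟨φ i (deviate z i x), by rintro _ ⟨x', rfl⟩; exact hmin x'.2⟩ (⟨x, hx⟩ : X i)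

theorem errN_continuousOn : ContinuousOn (errN X φ) (prodSet X) := by
  refine continuousOn_finsetSum _ fun i _ => ?_
  obtain ⟨K, hK⟩ := h.lipschitz i
  refine hK.continuousOn.sub ?_
  refine (LipschitzOnWith.of_le_add_mul K fun z hz z' hz' => ?_).continuousOn
  obtain ⟨x, hx, hx1, hx2⟩ := h.exists_iInf_eq hz i
  obtain ⟨x', hx', hx1', hx2'⟩ := h.exists_iInf_eq hz' i
  rw [hx1, hx1']
  refine (hx2 x' hx').trans ?_
  have h1 := hK.dist_le_mul _ (deviate_mem hz hx') _ (deviate_mem hz' hx')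
  have h2 : dist (deviate z i x') (deviate z' i x') ≤ dist z z' := by
    rw [dist_eq_norm, dist_eq_norm]
    exact norm_deviate_sub_le z z' i x'
  have h3 := (le_abs_self _).trans (h1.trans (mul_le_mul_of_nonneg_left h2 K.2))
  linarith

/-- The regret is tested at the single point `u` whose blocks are the best responses to the average.
Convexity of `∑ φ_i` handles the first terms of the error, concavity of `φ_i` in the other players'
blocks handles the minima, and the subgradient inequalities add up to the inner product over the
blocks. -/
theorem errN_average_le {G : PiLp 2 H → PiLp 2 H} (hG : IsNashOperator X φ G) {t : ℕ}
    (ht : 1 ≤ t) {v : ℕ → PiLp 2 H} (hv : ∀ τ, v τ ∈ prodSet X) {c : ℝ}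
    (hc : ∀ u ∈ prodSet X, ∑ τ ∈ Finset.range t, ⟪G (v τ), v τ - u⟫ ≤ t * c) :
    errN X φ (∑ τ ∈ Finset.range t, (t : ℝ)⁻¹ • v τ) ≤ c := by
  have ht' : (0 : ℝ) < t := by exact_mod_cast ht
  have hsum1 : ∑ τ ∈ Finset.range t, (t : ℝ)⁻¹ = 1 := by
    rw [Finset.sum_const, Finset.card_range, nsmul_eq_mul, mul_inv_cancel₀ ht'.ne']
  have hnn : ∀ τ ∈ Finset.range t, 0 ≤ (t : ℝ)⁻¹ := fun _ _ => by positivity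
  set vbar := ∑ τ ∈ Finset.range t, (t : ℝ)⁻¹ • v τ with hvbar
  have hvm : vbar ∈ prodSet X := h.convex_sum.1.sum_mem hnn hsum1 fun τ _ => hv τ
  choose x hx hx1 _ using fun i => h.exists_iInf_eq hvm i
  have hu : (WithLp.toLp 2 x : PiLp 2 H) ∈ prodSet X := fun i => hx i
  have h1 : ∑ i, φ i vbar ≤ ∑ τ ∈ Finset.range t, (t : ℝ)⁻¹ • ∑ i, φ i (v τ) :=
    h.convex_sum.map_sum_le hnn hsum1 fun τ _ => hv τ
  have h2 : ∀ i, ∑ τ ∈ Finset.range t, (t : ℝ)⁻¹ • φ i (deviate (v τ) i (x i)) ≤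
      φ i (deviate vbar i (x i)) := fun i => by
    rw [hvbar, deviate_sum ht]
    exact (h.concave_others i (x i) (hx i)).le_map_sum hnn hsum1 fun τ _ =>
      ⟨deviate_mem (hv τ) (hx i), by simp [deviate]⟩
  have h3 : ∀ τ i, φ i (v τ) - φ i (deviate (v τ) i (x i)) ≤ ⟪G (v τ) i, v τ i - x i⟫ := by
    intro τ i
    have := hG (v τ) (hv τ) i (x i) (hx i)
    simp only [deviate_self] at this
    rw [← neg_sub, inner_neg_right] at this
    linarith
  have h4 : errN X φ vbar ≤
      ∑ τ ∈ Finset.range t, (t : ℝ)⁻¹ • ∑ i, (φ i (v τ) - φ i (deviate (v τ) i (x i))) := by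
    simp only [errN, hx1, Finset.sum_sub_distrib, smul_sub]
    refine sub_le_sub h1 ?_
    simp only [Finset.smul_sum]
    rw [Finset.sum_comm]
    exact Finset.sum_le_sum fun i _ => h2 i
  refine h4.trans ?_
  rw [← Finset.smul_sum, smul_eq_mul, inv_mul_le_iff₀ ht']
  refine le_trans (Finset.sum_le_sum fun τ _ => ?_) (hc _ hu)
  rw [PiLp.inner_apply]
  exact Finset.sum_le_sum fun i _ => h3 τ i

end IsConvexNash

end Nash

/-! ### Conditioning on the past noises. -/

section Past

variable {S W α : Type*} [mS : MeasurableSpace S] {mW : MeasurableSpace W} [MeasurableSpace α]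
  {P : Measure W} {ζ : ℕ → W → S}

/-- The σ-algebra generated by the first `n` noises. -/
abbrev past (ζ : ℕ → W → S) (n : ℕ) : MeasurableSpace W := ⨆ i ∈ Iio n, mS.comap (ζ i)

theorem past_mono {k n : ℕ} (h : k ≤ n) : past ζ k ≤ past ζ n :=
  biSup_mono fun _ hi => lt_of_lt_of_le hi h

theorem past_le (hζ : ∀ i, Measurable (ζ i)) (n : ℕ) : past ζ n ≤ mW :=
  iSup₂_le fun i _ => (hζ i).comap_le

theorem measurable_past {i n : ℕ} (h : i < n) : Measurable[past ζ n] (ζ i) :=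
  Measurable.of_comap_le (le_biSup (fun i => mS.comap (ζ i)) (show i ∈ Iio n from h))

theorem indepFun_past (hζ : ∀ i, Measurable (ζ i)) (hind : iIndepFun ζ P) {n : ℕ} {U : W → α}
    (hU : Measurable[past ζ n] U) : IndepFun U (ζ n) P := by
  have h := indep_iSup_of_disjoint (fun i => (hζ i).comap_le) hind
    (S := Iio n) (T := {n}) (by simp)
  rw [iSup_singleton] at h
  rw [IndepFun_iff_Indep]
  exact indep_of_indep_of_le_left h hU.comap_le

/-- A substitute for conditional expectation: the joint law of `U` and the fresh noise is a product,
so `U` can be frozen while the noise is integrated. This is how oracle assumptions stated for fixed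
points apply at random iterates. -/
theorem lintegral_past [IsProbabilityMeasure P] (hζ : ∀ i, Measurable (ζ i))
    (hind : iIndepFun ζ P) {n : ℕ} {U : W → α} (hU : Measurable[past ζ n] U) {g : α × S → ℝ≥0∞}
    (hg : Measurable g) :
    ∫⁻ x, g (U x, ζ n x) ∂P = ∫⁻ x, ∫⁻ x', g (U x, ζ n x') ∂P ∂P := by
  have hU' : Measurable U := hU.mono (past_le hζ n) le_rfl
  have h := (indepFun_iff_map_prod_eq_prod_map_map hU'.aemeasurable (hζ n).aemeasurable).1
    (indepFun_past hζ hind hU)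
  have := Measure.isProbabilityMeasure_map (μ := P) hU'.aemeasurable
  have := Measure.isProbabilityMeasure_map (μ := P) (hζ n).aemeasurable
  rw [← lintegral_map (f := g) hg (hU'.prodMk (hζ n)), h, lintegral_prod _ hg.aemeasurable,
    lintegral_map hg.lintegral_prod_right' hU']
  refine lintegral_congr fun x => ?_
  exact lintegral_map (hg.comp measurable_prodMk_left) (hζ n)

theorem integral_past [IsProbabilityMeasure P] (hζ : ∀ i, Measurable (ζ i))
    (hind : iIndepFun ζ P) {n : ℕ} {U : W → α} (hU : Measurable[past ζ n] U) {g : α × S → ℝ}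
    (hg : Measurable g) (hint : Integrable (fun x => g (U x, ζ n x)) P) :
    ∫ x, g (U x, ζ n x) ∂P = ∫ x, ∫ x', g (U x, ζ n x') ∂P ∂P := by
  have hU' : Measurable U := hU.mono (past_le hζ n) le_rfl
  have h := (indepFun_iff_map_prod_eq_prod_map_map hU'.aemeasurable (hζ n).aemeasurable).1
    (indepFun_past hζ hind hU)
  have := Measure.isProbabilityMeasure_map (μ := P) hU'.aemeasurable
  have := Measure.isProbabilityMeasure_map (μ := P) (hζ n).aemeasurable
  have hm := hU'.prodMk (hζ n)
  have hint' : Integrable g (P.map fun x => (U x, ζ n x)) :=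
    (integrable_map_measure hg.aestronglyMeasurable hm.aemeasurable).2 hint
  rw [← integral_map (f := g) hm.aemeasurable hg.aestronglyMeasurable, h]
  rw [h] at hint'
  rw [integral_prod _ hint', integral_map hU'.aemeasurable
    hg.stronglyMeasurable.integral_prod_right'.aestronglyMeasurable]
  refine integral_congr_ae (.of_forall fun x => ?_)
  exact integral_map (hζ n).aemeasurable
    (hg.comp measurable_prodMk_left).aestronglyMeasurable

/-- Taking the expectation over the fresh noise in a product with a factor that depends on the
past. -/
theorem lintegral_mul_past_le [IsProbabilityMeasure P] (hζ : ∀ i, Measurable (ζ i))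
    (hind : iIndepFun ζ P) {n : ℕ} {U : W → α} (hU : Measurable[past ζ n] U) {A : W → ℝ≥0∞}
    (hA : Measurable[past ζ n] A) {g : α × S → ℝ≥0∞} (hg : Measurable g) {C : ℝ≥0∞}
    (hC : ∀ x, ∫⁻ x', g (U x, ζ n x') ∂P ≤ C) :
    ∫⁻ x, A x * g (U x, ζ n x) ∂P ≤ (∫⁻ x, A x ∂P) * C := by
  have h := lintegral_past hζ hind (hA.prodMk hU)
    (g := fun q : (ℝ≥0∞ × α) × S => q.1.1 * g (q.1.2, q.2)) (by fun_prop)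
  simp only at h
  have hA' : Measurable A := hA.mono (past_le hζ n) le_rfl
  rw [h, ← lintegral_mul_const _ hA']
  refine lintegral_mono fun x => ?_
  rw [lintegral_const_mul]
  · gcongr
    exact hC x
  · exact hg.comp (measurable_const.prodMk (hζ n))

/-- Exponential moments of a sum whose terms have bounded conditional exponential moments. -/
theorem lintegral_exp_sum_le [IsProbabilityMeasure P] {κ : ℕ → ℕ} {f : ℕ → W → ℝ} {c : ℝ}
    (hf : ∀ n, Measurable[past ζ (κ (n + 1))] (f n)) (hκ : Monotone κ)
    (h : ∀ n, ∀ A : W → ℝ≥0∞, Measurable[past ζ (κ n)] A →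
      ∫⁻ x, A x * ENNReal.ofReal (Real.exp (f n x)) ∂P ≤
        (∫⁻ x, A x ∂P) * ENNReal.ofReal (Real.exp c)) (t : ℕ) :
    ∫⁻ x, ENNReal.ofReal (Real.exp (∑ n ∈ Finset.range t, f n x)) ∂P ≤
      ENNReal.ofReal (Real.exp (t * c)) := by
  have hmeas : ∀ t : ℕ, Measurable[past ζ (κ t)] fun x => ∑ n ∈ Finset.range t, f n x :=
    fun t => Finset.measurable_fun_sum _ fun n hn =>
      (hf n).mono (past_mono (hκ (Finset.mem_range.1 hn))) le_rfl
  induction t with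
  | zero => simp
  | succ t ih =>
    simp only [Finset.sum_range_succ, Real.exp_add, ENNReal.ofReal_mul (Real.exp_pos _).le]
    -- The exponential of the earlier partial sum plays the role of the past-measurable weight `A`.
    refine (h t _ (ENNReal.measurable_ofReal.comp
      (Real.measurable_exp.comp (hmeas t)))).trans ?_
    rw [Nat.cast_add, Nat.cast_one, add_mul, one_mul, Real.exp_add,
      ENNReal.ofReal_mul (Real.exp_pos _).le]
    gcongr
    exact ih

end Past

/-! ### Scalar exponential-moment inequalities. -/

section Moments

variable {W : Type*} {mW : MeasurableSpace W} {P : Measure W} {f X : W → ℝ}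

theorem integrable_of_lintegral_le (hf : Measurable f) (h0 : ∀ x, 0 ≤ f x) {c : ℝ} (hc : 0 ≤ c)
    (h : ∫⁻ x, ENNReal.ofReal (f x) ∂P ≤ ENNReal.ofReal c) :
    Integrable f P ∧ ∫ x, f x ∂P ≤ c := by
  refine ⟨⟨hf.aestronglyMeasurable, ?_⟩, ?_⟩
  · rw [hasFiniteIntegral_iff_ofReal (.of_forall h0)]
    exact h.trans_lt ENNReal.ofReal_lt_top
  · rw [integral_eq_lintegral_of_nonneg_ae (.of_forall h0) hf.aestronglyMeasurable]
    exact ENNReal.toReal_le_of_le_ofReal hc h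

theorem lintegral_ofReal_le_of_integral_le (h0 : ∀ x, 0 ≤ f x) (hf : Integrable f P) {c : ℝ}
    (h : ∫ x, f x ∂P ≤ c) : ∫⁻ x, ENNReal.ofReal (f x) ∂P ≤ ENNReal.ofReal c := by
  rw [← ofReal_integral_eq_lintegral_ofReal hf (.of_forall h0)]
  exact ENNReal.ofReal_le_ofReal h

/-- Jensen's inequality for exponential moments. -/
theorem integral_exp_mul_le [IsProbabilityMeasure P] (hf : Measurable f)
    (hi : Integrable (fun x => Real.exp (f x)) P) (h : ∫ x, Real.exp (f x) ∂P ≤ Real.exp 1)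
    {c : ℝ} (hc : 0 ≤ c) (hc1 : c ≤ 1) :
    Integrable (fun x => Real.exp (c * f x)) P ∧
      ∫ x, Real.exp (c * f x) ∂P ≤ Real.exp c := by
  -- The chord of `exp` between `0` and `f x - 1`; since `exp (f x - 1)` has mean at most 1, the
  -- bound integrates to exactly `exp c`.
  have key : ∀ x, Real.exp (c * f x) ≤
      Real.exp c * (1 - c) + Real.exp c * c * Real.exp (-1) * Real.exp (f x) := fun x => by
    have := convexOn_exp.2 (mem_univ 0) (mem_univ (f x - 1)) (sub_nonneg.2 hc1) hc (by ring)
    simp only [smul_eq_mul, mul_zero, zero_add, Real.exp_zero, mul_one] at this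
    rw [show c * f x = c + c * (f x - 1) by ring, Real.exp_add]
    refine (mul_le_mul_of_nonneg_left this (Real.exp_pos c).le).trans (le_of_eq ?_)
    rw [show f x - 1 = -1 + f x by ring, Real.exp_add]
    ring
  have hi' : Integrable (fun x =>
      Real.exp c * (1 - c) + Real.exp c * c * Real.exp (-1) * Real.exp (f x)) P :=
    (integrable_const _).add (hi.const_mul _)
  have hi'' : Integrable (fun x => Real.exp (c * f x)) P :=
    hi'.mono' (by fun_prop) (.of_forall fun x => by
      rw [Real.norm_of_nonneg (Real.exp_pos _).le]; exact key x)
  refine ⟨hi'', (integral_mono hi'' hi' key).trans ?_⟩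
  rw [integral_add (integrable_const _) (hi.const_mul _)]
  simp only [integral_const, probReal_univ, smul_eq_mul, one_mul]
  rw [integral_const_mul]
  have h1 : Real.exp c * c * Real.exp (-1) * ∫ x, Real.exp (f x) ∂P ≤
      Real.exp c * c * Real.exp (-1) * Real.exp 1 := by gcongr
  have h2 : Real.exp (-1) * Real.exp 1 = 1 := by rw [← Real.exp_add]; simp
  have h3 : Real.exp c * c * Real.exp (-1) * Real.exp 1 = Real.exp c * c := by
    rw [mul_assoc, h2, mul_one]
  linarith

/-- Removes the linear term of the exponential, so that only the mean and a Gaussian-type moment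
matter. For `x ≤ 0` second-order bounds suffice, for `x ≥ 16/9` the square already dominates, and in
between Taylor polynomials are compared. -/
theorem exp_le_add_exp_sq (x : ℝ) : Real.exp x ≤ x + Real.exp (9 / 16 * x ^ 2) := by
  rcases le_total x 0 with hx | hx
  · have h1 := Real.add_one_le_exp (9 / 16 * x ^ 2)
    have h2 := Real.quadratic_le_exp_of_nonneg (neg_nonneg.2 hx)
    have h3 : Real.exp x * Real.exp (-x) = 1 := by rw [← Real.exp_add]; simp
    have h4 : Real.exp x * (1 - x + x ^ 2 / 2) ≤ 1 := by
      rw [← h3]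
      gcongr
      linarith
    have h5 : 1 ≤ (1 + x + x ^ 2 / 2) * (1 - x + x ^ 2 / 2) := by nlinarith [sq_nonneg (x ^ 2)]
    have h6 : (0 : ℝ) < 1 - x + x ^ 2 / 2 := by nlinarith
    have h7 : Real.exp x ≤ 1 + x + x ^ 2 / 2 := le_of_mul_le_mul_right (h4.trans h5) h6
    nlinarith [sq_nonneg x]
  rcases le_total (16 / 9) x with hx' | hx'
  · have : Real.exp x ≤ Real.exp (9 / 16 * x ^ 2) := Real.exp_le_exp.2 (by nlinarith)
    linarith
  have h1 : Real.exp x ≤ 1 + x + x ^ 2 / 2 + x ^ 3 / 6 + x ^ 4 / 24 + x ^ 5 / 120 +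
      x ^ 6 / 360 := by
    -- The remainder after six terms is at most twice the next one, `2 * x ^ 6 / 720`.
    have h := Complex.exp_bound' (x := (x : ℂ)) (n := 6) (by
      rw [Complex.norm_real, Real.norm_of_nonneg hx]; push_cast; linarith)
    rw [Complex.norm_real, Real.norm_of_nonneg hx] at h
    have h2 : Complex.exp x - ∑ m ∈ Finset.range 6, (x : ℂ) ^ m / (m.factorial : ℂ) =
        ((Real.exp x - ∑ m ∈ Finset.range 6, x ^ m / (m.factorial : ℝ) : ℝ) : ℂ) := by
      push_cast; rfl
    rw [h2, Complex.norm_real] at h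
    have h3 := (le_abs_self _).trans h
    simp only [Finset.sum_range_succ, Finset.sum_range_zero, Nat.factorial] at h3
    norm_num at h3
    linarith
  have h2 : 1 + 9 / 16 * x ^ 2 + (9 / 16 * x ^ 2) ^ 2 / 2 + (9 / 16 * x ^ 2) ^ 3 / 6 ≤
      Real.exp (9 / 16 * x ^ 2) := by
    have h := Real.sum_le_exp_of_nonneg (x := 9 / 16 * x ^ 2) (by positivity) 4
    simp only [Finset.sum_range_succ, Finset.sum_range_zero, Nat.factorial] at h
    norm_num at h ⊢
    linarith
  have h3 : 0 ≤ 1 / 16 - x / 6 + (81 / 512 - 1 / 24) * x ^ 2 - x ^ 3 / 120 +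
      (729 / 24576 - 1 / 360) * x ^ 4 := by
    nlinarith [sq_nonneg (x * (x - 155 / 1000)), sq_nonneg (x - 7 / 10)]
  nlinarith [mul_nonneg (sq_nonneg x) h3]

/-- The moment generating function of a sub-Gaussian random variable. -/
theorem lintegral_exp_mul_le [IsProbabilityMeasure P] (hX : Measurable X) (hXi : Integrable X P)
    {b : ℝ} (hb : 0 ≤ b) (hXb : ∫ x, X x ∂P ≤ b)
    (hi : Integrable (fun x => Real.exp (X x ^ 2)) P)
    (h : ∫ x, Real.exp (X x ^ 2) ∂P ≤ Real.exp 1) {s : ℝ} (hs : 0 ≤ s) :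
    ∫⁻ x, ENNReal.ofReal (Real.exp (s * X x)) ∂P ≤
      ENNReal.ofReal (Real.exp (3 / 4 * s ^ 2 + s * b)) := by
  have hX2 : Measurable fun x => X x ^ 2 := hX.pow_const 2
  have hsb := mul_nonneg hs hb
  suffices H : ∃ g : W → ℝ, Integrable g P ∧ (∀ x, Real.exp (s * X x) ≤ g x) ∧
      ∫ x, g x ∂P ≤ Real.exp (3 / 4 * s ^ 2 + s * b) by
    obtain ⟨g, hg, hle, hint⟩ := H
    exact (lintegral_mono fun x => ENNReal.ofReal_le_ofReal (hle x)).trans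
      (lintegral_ofReal_le_of_integral_le (fun x => (Real.exp_pos _).le.trans (hle x)) hg hint)
  -- `4 / 3` is where `9 / 16 * s ^ 2` reaches 1, the largest exponent Jensen allows. Beyond it,
  -- Young's inequality `sX ≤ 3/8 s² + 2/3 X²` is used, with `2 / 3 ≤ 3 / 8 * s ^ 2`.
  rcases le_total s (4 / 3) with hs' | hs'
  · obtain ⟨h1, h2⟩ := integral_exp_mul_le hX2 hi h (c := 9 / 16 * s ^ 2) (by positivity)
      (by nlinarith)
    refine ⟨_, (hXi.const_mul s).add h1, fun x => ?_, ?_⟩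
    · refine (exp_le_add_exp_sq (s * X x)).trans (le_of_eq ?_)
      rw [mul_pow]
      simp [mul_assoc]
    · simp only [Pi.add_apply]
      rw [integral_add (hXi.const_mul s) h1, integral_const_mul]
      have h3 : s * ∫ x, X x ∂P ≤ s * b := by gcongr
      have h4 : 1 ≤ Real.exp (9 / 16 * s ^ 2) := Real.one_le_exp (by positivity)
      have h5 := Real.add_one_le_exp (s * b)
      calc s * ∫ x, X x ∂P + ∫ x, Real.exp (9 / 16 * s ^ 2 * X x ^ 2) ∂P
          ≤ s * b * Real.exp (9 / 16 * s ^ 2) + Real.exp (9 / 16 * s ^ 2) := by nlinarith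
        _ ≤ Real.exp (s * b) * Real.exp (9 / 16 * s ^ 2) := by nlinarith
        _ ≤ Real.exp (3 / 4 * s ^ 2 + s * b) := by
          rw [← Real.exp_add]
          exact Real.exp_le_exp.2 (by nlinarith)
  · obtain ⟨h1, h2⟩ := integral_exp_mul_le hX2 hi h (c := 2 / 3) (by norm_num) (by norm_num)
    refine ⟨_, h1.const_mul (Real.exp (3 / 8 * s ^ 2)), fun x => ?_, ?_⟩
    · rw [← Real.exp_add]
      exact Real.exp_le_exp.2 (by nlinarith [sq_nonneg (3 / 4 * s - X x)])
    · rw [integral_const_mul]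
      refine (mul_le_mul_of_nonneg_left h2 (Real.exp_pos _).le).trans ?_
      rw [← Real.exp_add]
      exact Real.exp_le_exp.2 (by nlinarith)

/-- Markov's inequality for exponential moments. -/
theorem measureReal_lt_le_exp [IsProbabilityMeasure P] (hf : Measurable f) {c d : ℝ}
    (h : ∫⁻ x, ENNReal.ofReal (Real.exp (f x)) ∂P ≤ ENNReal.ofReal (Real.exp c)) :
    P.real {x | d < f x} ≤ Real.exp (c - d) := by
  have hpos : 0 < Real.exp d := Real.exp_pos d
  have h1 : P {x | d < f x} ≤ ENNReal.ofReal (Real.exp (c - d)) := by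
    calc P {x | d < f x}
        ≤ P {x | ENNReal.ofReal (Real.exp d) ≤ ENNReal.ofReal (Real.exp (f x))} :=
          measure_mono fun x hx => ENNReal.ofReal_le_ofReal (Real.exp_le_exp.2 (le_of_lt hx))
      _ ≤ (∫⁻ x, ENNReal.ofReal (Real.exp (f x)) ∂P) / ENNReal.ofReal (Real.exp d) :=
          meas_ge_le_lintegral_div (by fun_prop) (by simpa using hpos) ENNReal.ofReal_ne_top
      _ ≤ ENNReal.ofReal (Real.exp c) / ENNReal.ofReal (Real.exp d) := by gcongr
      _ = ENNReal.ofReal (Real.exp (c - d)) := by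
          rw [← ENNReal.ofReal_div_of_pos hpos, Real.exp_sub]
  exact ENNReal.toReal_le_of_le_ofReal (Real.exp_pos _).le h1

end Moments

/-! ### Moments and deviations of the oracle errors along the iterates. -/

section OracleNoise

variable {E : Type*} [NormedAddCommGroup E] [InnerProductSpace ℝ E] [FiniteDimensional ℝ E]
  [MeasurableSpace E] [BorelSpace E] {p : Seminorm ℝ E}
  {S W T : Type*} [MeasurableSpace S] {mW : MeasurableSpace W} [MeasurableSpace T]
  {P : Measure W} [IsProbabilityMeasure P] {ζ : ℕ → W → S} {err : T × S → E} {M μ : ℝ}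

variable (hp : ∀ x, p x = 0 → x = 0) (hζ : ∀ i, Measurable (ζ i)) (herr : Measurable err)
include hp hζ herr

theorem integrable_err {z : T} {n : ℕ}
    (hmom : ∫⁻ x, ENNReal.ofReal (conjNorm p (err (z, ζ n x)) ^ 2) ∂P ≤ ENNReal.ofReal (M ^ 2)) :
    Integrable (fun x => err (z, ζ n x)) P := by
  have hc := (conjNorm_continuous hp).measurable
  have hm : Measurable fun x => err (z, ζ n x) :=
    herr.comp (measurable_const.prodMk (hζ n))
  obtain ⟨C, hC, hC'⟩ := exists_norm_le_conjNorm hp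
  have h1 := (integrable_of_lintegral_le (f := fun x => conjNorm p (err (z, ζ n x)) ^ 2)
    ((hc.comp hm).pow_const 2) (fun x => sq_nonneg _) (sq_nonneg M) hmom).1
  refine (((integrable_const (1 : ℝ)).add h1).const_mul C).mono' hm.aestronglyMeasurable
    (.of_forall fun x => (hC' _).trans ?_)
  simp only [Pi.add_apply]
  gcongr
  nlinarith [sq_nonneg (conjNorm p (err (z, ζ n x)) - 1), conjNorm_nonneg hp (err (z, ζ n x))]

theorem integral_inner_err_le {z : T} {n : ℕ}
    (hmom : ∫⁻ x, ENNReal.ofReal (conjNorm p (err (z, ζ n x)) ^ 2) ∂P ≤ ENNReal.ofReal (M ^ 2))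
    (hbias : conjNorm p (∫ x, err (z, ζ n x) ∂P) ≤ μ) {v : E} (hv : p v ≤ 1) :
    ∫ x, ⟪err (z, ζ n x), v⟫ ∂P ≤ μ := by
  have h1 := integrable_err hp hζ herr hmom
  simp only [real_inner_comm v]
  rw [integral_inner h1, real_inner_comm]
  exact (inner_le_conjNorm_of_le_one hp _ hv).trans hbias

variable (hind : iIndepFun ζ P)
include hind

theorem integrable_sq_err {n : ℕ} {U : W → T} (hU : Measurable[past ζ n] U)
    (hmom : ∀ z, ∫⁻ x, ENNReal.ofReal (conjNorm p (err (z, ζ n x)) ^ 2) ∂P ≤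
      ENNReal.ofReal (M ^ 2)) :
    Integrable (fun x => conjNorm p (err (U x, ζ n x)) ^ 2) P ∧
      ∫ x, conjNorm p (err (U x, ζ n x)) ^ 2 ∂P ≤ M ^ 2 := by
  have hc := (conjNorm_continuous hp).measurable
  have hU' : Measurable U := hU.mono (past_le hζ n) le_rfl
  refine integrable_of_lintegral_le
    ((hc.comp (herr.comp (hU'.prodMk (hζ n)))).pow_const 2) (fun x => sq_nonneg _) (sq_nonneg M) ?_
  have := lintegral_mul_past_le hζ hind hU (A := fun _ => 1) measurable_const
    (g := fun q => ENNReal.ofReal (conjNorm p (err q) ^ 2)) (by fun_prop) (fun x => hmom (U x))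
  simpa using this

theorem integrable_inner_err {n : ℕ} {U : W → T} (hU : Measurable[past ζ n] U) {V : W → E}
    (hV : Measurable[past ζ n] V) (hV1 : ∀ x, p (V x) ≤ 1)
    (hmom : ∀ z, ∫⁻ x, ENNReal.ofReal (conjNorm p (err (z, ζ n x)) ^ 2) ∂P ≤
      ENNReal.ofReal (M ^ 2)) (hbias : ∀ z, conjNorm p (∫ x, err (z, ζ n x) ∂P) ≤ μ) :
    Integrable (fun x => ⟪err (U x, ζ n x), V x⟫) P ∧
      ∫ x, ⟪err (U x, ζ n x), V x⟫ ∂P ≤ μ := by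
  have hU' : Measurable U := hU.mono (past_le hζ n) le_rfl
  have hV' : Measurable V := hV.mono (past_le hζ n) le_rfl
  have hg : Measurable fun q : (T × E) × S => ⟪err (q.1.1, q.2), q.1.2⟫ :=
    Measurable.inner (by fun_prop) (by fun_prop)
  have hint : Integrable (fun x => ⟪err (U x, ζ n x), V x⟫) P := by
    refine ((integrable_const (1 : ℝ)).add (integrable_sq_err hp hζ herr hind hU hmom).1).mono'
      (hg.comp ((hU'.prodMk hV').prodMk (hζ n))).aestronglyMeasurable (.of_forall fun x => ?_)
    refine (abs_inner_le_conjNorm hp _ (hV1 x)).trans ?_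
    simp only [Pi.add_apply]
    nlinarith [sq_nonneg (conjNorm p (err (U x, ζ n x)) - 1),
      conjNorm_nonneg hp (err (U x, ζ n x))]
  refine ⟨hint, ?_⟩
  rw [integral_past hζ hind (hU.prodMk hV) hg hint]
  have hle : ∀ x, ∫ x', ⟪err (U x, ζ n x'), V x⟫ ∂P ≤ μ := fun x =>
    integral_inner_err_le hp hζ herr (hmom _) (hbias _) (hV1 x)
  -- Without integrability the outer integral has the default value 0, and `μ ≥ 0` still bounds it.
  by_cases hi : Integrable (fun x => ∫ x', ⟪err (U x, ζ n x'), V x⟫ ∂P) P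
  · simpa using integral_mono hi (integrable_const μ) hle
  · have h0 : 0 ≤ μ := by
      have : Nonempty W := P.nonempty_of_neZero
      exact (conjNorm_nonneg hp _).trans (hbias (U (Classical.arbitrary W)))
    rw [integral_undef hi]
    exact h0

omit [IsProbabilityMeasure P] hind in
theorem integrable_exp_err {z : T} {n : ℕ}
    (hexp : ∫⁻ x, ENNReal.ofReal (Real.exp (conjNorm p (err (z, ζ n x)) ^ 2 / M ^ 2)) ∂P ≤
      ENNReal.ofReal (Real.exp 1)) :
    Integrable (fun x => Real.exp (conjNorm p (err (z, ζ n x)) ^ 2 / M ^ 2)) P ∧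
      ∫ x, Real.exp (conjNorm p (err (z, ζ n x)) ^ 2 / M ^ 2) ∂P ≤ Real.exp 1 := by
  have hc := (conjNorm_continuous hp).measurable
  have hm : Measurable fun x => err (z, ζ n x) :=
    herr.comp (measurable_const.prodMk (hζ n))
  exact integrable_of_lintegral_le
    (Real.measurable_exp.comp (((hc.comp hm).pow_const 2).div_const _))
    (fun x => (Real.exp_pos _).le) (Real.exp_pos _).le hexp

omit hind in
-- With `p v ≤ 1`, the scalar `⟪err, v⟫ / M` has square at most `‖err‖_*² / M²`, so it inherits the
-- exponential moment, and its mean is at most `μ / M`.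
theorem lintegral_exp_inner_err_le (hM : 0 < M) {z : T} {n : ℕ}
    (hmom : ∫⁻ x, ENNReal.ofReal (conjNorm p (err (z, ζ n x)) ^ 2) ∂P ≤ ENNReal.ofReal (M ^ 2))
    (hbias : conjNorm p (∫ x, err (z, ζ n x) ∂P) ≤ μ)
    (hexp : ∫⁻ x, ENNReal.ofReal (Real.exp (conjNorm p (err (z, ζ n x)) ^ 2 / M ^ 2)) ∂P ≤
      ENNReal.ofReal (Real.exp 1)) {v : E} (hv : p v ≤ 1) {s : ℝ} (hs : 0 ≤ s) :
    ∫⁻ x, ENNReal.ofReal (Real.exp (s * (⟪err (z, ζ n x), v⟫ / M))) ∂P ≤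
      ENNReal.ofReal (Real.exp (3 / 4 * s ^ 2 + s * (μ / M))) := by
  have hm : Measurable fun x => err (z, ζ n x) :=
    herr.comp (measurable_const.prodMk (hζ n))
  have hX : Measurable fun x => ⟪err (z, ζ n x), v⟫ / M :=
    (hm.inner measurable_const).div_const M
  obtain ⟨h1, h2⟩ := integrable_exp_err hp hζ herr hexp
  have hle : ∀ x, Real.exp ((⟪err (z, ζ n x), v⟫ / M) ^ 2) ≤
      Real.exp (conjNorm p (err (z, ζ n x)) ^ 2 / M ^ 2) := fun x => by
    rw [div_pow, ← sq_abs ⟪err (z, ζ n x), v⟫]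
    gcongr
    exact abs_inner_le_conjNorm hp _ hv
  have h3 : Integrable (fun x => Real.exp ((⟪err (z, ζ n x), v⟫ / M) ^ 2)) P :=
    h1.mono' (Real.measurable_exp.comp (hX.pow_const 2)).aestronglyMeasurable
      (.of_forall fun x => by rw [Real.norm_of_nonneg (Real.exp_pos _).le]; exact hle x)
  have hμ : 0 ≤ μ := (conjNorm_nonneg hp _).trans hbias
  refine lintegral_exp_mul_le hX
    (((integrable_err hp hζ herr hmom).inner_const v).div_const M) (div_nonneg hμ hM.le) ?_ h3
    ((integral_mono h3 h1 hle).trans h2) hs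
  rw [integral_div]
  gcongr
  exact integral_inner_err_le hp hζ herr hmom hbias hv

/-- The deviation bound for the sum of the inner products with the oracle errors. -/
theorem measureReal_sum_inner_err_le (hM : 0 < M) {κ : ℕ → ℕ} (hκ : StrictMono κ) {U : ℕ → W → T}
    (hU : ∀ τ, Measurable[past ζ (κ τ)] (U τ)) {V : ℕ → W → E}
    (hV : ∀ τ, Measurable[past ζ (κ τ)] (V τ)) (hV1 : ∀ τ x, p (V τ x) ≤ 1)
    (hmom : ∀ z n, ∫⁻ x, ENNReal.ofReal (conjNorm p (err (z, ζ n x)) ^ 2) ∂P ≤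
      ENNReal.ofReal (M ^ 2)) (hbias : ∀ z n, conjNorm p (∫ x, err (z, ζ n x) ∂P) ≤ μ)
    (hexp : ∀ z n, ∫⁻ x, ENNReal.ofReal (Real.exp (conjNorm p (err (z, ζ n x)) ^ 2 / M ^ 2)) ∂P ≤
      ENNReal.ofReal (Real.exp 1)) {t : ℕ} (ht : 1 ≤ t) {Λ : ℝ} (hΛ : 0 < Λ) :
    P.real {x | t * (μ / M) + Λ * √t <
      ∑ τ ∈ Finset.range t, ⟪err (U τ x, ζ (κ τ) x), V τ x⟫ / M} ≤ Real.exp (-Λ ^ 2 / 3) := by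
  have ht' : (0 : ℝ) < t := by exact_mod_cast ht
  have hst : 0 < √(t : ℝ) := Real.sqrt_pos.2 ht'
  -- The minimizer of `3/4 s² t - sΛ√t`, with minimal value `-Λ²/3`.
  set s : ℝ := 2 * Λ / (3 * √t) with hs
  have hs0 : 0 < s := by positivity
  have hg : Measurable fun q : (T × E) × S => ⟪err (q.1.1, q.2), q.1.2⟫ / M :=
    (Measurable.inner (by fun_prop) (by fun_prop)).div_const M
  have hmeas : ∀ τ, Measurable[past ζ (κ (τ + 1))] fun x =>
      ⟪err (U τ x, ζ (κ τ) x), V τ x⟫ / M := fun τ => by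
    have hlt : κ τ < κ (τ + 1) := hκ (Nat.lt_succ_self τ)
    exact hg.comp ((((hU τ).mono (past_mono hlt.le) le_rfl).prodMk
      ((hV τ).mono (past_mono hlt.le) le_rfl)).prodMk (measurable_past hlt))
  have h := lintegral_exp_sum_le (P := P) (κ := κ)
    (f := fun τ x => s * (⟪err (U τ x, ζ (κ τ) x), V τ x⟫ / M))
    (c := 3 / 4 * s ^ 2 + s * (μ / M)) (fun τ => (hmeas τ).const_mul s) hκ.monotone
    (fun τ A hA => lintegral_mul_past_le hζ hind ((hU τ).prodMk (hV τ)) hA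
      (g := fun q : (T × E) × S =>
        ENNReal.ofReal (Real.exp (s * (⟪err (q.1.1, q.2), q.1.2⟫ / M))))
      (ENNReal.measurable_ofReal.comp (Real.measurable_exp.comp (hg.const_mul s)))
      (fun x => lintegral_exp_inner_err_le hp hζ herr hM (hmom _ _) (hbias _ _) (hexp _ _)
        (hV1 τ x) hs0.le)) t
  have hmeas' : Measurable fun x => ∑ τ ∈ Finset.range t,
      s * (⟪err (U τ x, ζ (κ τ) x), V τ x⟫ / M) :=
    Finset.measurable_fun_sum _ fun τ _ =>
      ((hmeas τ).const_mul s).mono (past_le hζ _) le_rfl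
  have h2 := measureReal_lt_le_exp hmeas' (d := s * (t * (μ / M) + Λ * √t)) h
  refine le_trans (le_of_eq ?_) (h2.trans (le_of_eq ?_))
  · congr 1
    ext x
    rw [mem_ofPred_eq, mem_ofPred_eq, ← Finset.mul_sum, mul_lt_mul_iff_right₀ hs0]
  · congr 1
    have h3 : s * √t = 2 * Λ / 3 := by rw [hs]; field_simp
    have h4 : s ^ 2 * t = 4 * Λ ^ 2 / 9 := by
      calc s ^ 2 * t = (s * √t) ^ 2 := by rw [mul_pow, Real.sq_sqrt ht'.le]
        _ = 4 * Λ ^ 2 / 9 := by rw [h3]; ring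
    linear_combination (3 / 4) * h4 - Λ * h3

omit hind in
theorem lintegral_exp_mul_err_le {z : T} {n : ℕ}
    (hexp : ∫⁻ x, ENNReal.ofReal (Real.exp (conjNorm p (err (z, ζ n x)) ^ 2 / M ^ 2)) ∂P ≤
      ENNReal.ofReal (Real.exp 1)) {c : ℝ} (hc : 0 ≤ c) (hc1 : c ≤ 1) :
    ∫⁻ x, ENNReal.ofReal (Real.exp (c * (conjNorm p (err (z, ζ n x)) ^ 2 / M ^ 2))) ∂P ≤
      ENNReal.ofReal (Real.exp c) := by
  have hcn := (conjNorm_continuous hp).measurable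
  have hm : Measurable fun x => err (z, ζ n x) :=
    herr.comp (measurable_const.prodMk (hζ n))
  obtain ⟨h1, h2⟩ := integrable_exp_err hp hζ herr hexp
  obtain ⟨h3, h4⟩ := integral_exp_mul_le (((hcn.comp hm).pow_const 2).div_const _) h1 h2 hc hc1
  exact lintegral_ofReal_le_of_integral_le (fun x => (Real.exp_pos _).le) h3 h4

/-- The deviation bound for the sum of the squared oracle errors. -/
theorem measureReal_sum_sq_err_le {U₁ U₂ : ℕ → W → T}
    (hU₁ : ∀ τ, Measurable[past ζ (2 * τ)] (U₁ τ))
    (hU₂ : ∀ τ, Measurable[past ζ (2 * τ + 1)] (U₂ τ))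
    (hexp : ∀ z n, ∫⁻ x, ENNReal.ofReal (Real.exp (conjNorm p (err (z, ζ n x)) ^ 2 / M ^ 2)) ∂P ≤
      ENNReal.ofReal (Real.exp 1)) (t : ℕ) {Λ : ℝ} :
    P.real {x | 18 / 7 * t + Λ * t < ∑ τ ∈ Finset.range t,
      (6 / 7 * (conjNorm p (err (U₁ τ x, ζ (2 * τ) x)) ^ 2 / M ^ 2) +
        1 * (conjNorm p (err (U₂ τ x, ζ (2 * τ + 1) x)) ^ 2 / M ^ 2))} ≤ Real.exp (-Λ * t) := by
  have hcn := (conjNorm_continuous hp).measurable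
  have hg : ∀ c : ℝ, Measurable fun q : T × S => c * (conjNorm p (err q) ^ 2 / M ^ 2) :=
    fun c => (((hcn.comp herr).pow_const 2).div_const _).const_mul c
  have hge : ∀ c : ℝ, Measurable fun q : T × S =>
      ENNReal.ofReal (Real.exp (c * (conjNorm p (err q) ^ 2 / M ^ 2))) :=
    fun c => ENNReal.measurable_ofReal.comp (Real.measurable_exp.comp (hg c))
  have hκ : Monotone fun τ : ℕ => 2 * τ := fun a b h => Nat.mul_le_mul_left 2 h
  have h₁ : ∀ τ, Measurable[past ζ (2 * τ + 1)] fun x => (U₁ τ x, ζ (2 * τ) x) := fun τ =>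
    ((hU₁ τ).mono (past_mono (Nat.le_succ _)) le_rfl).prodMk (measurable_past (Nat.lt_succ_self _))
  have h₂ : ∀ τ, Measurable[past ζ (2 * (τ + 1))] fun x => (U₂ τ x, ζ (2 * τ + 1) x) := fun τ =>
    ((hU₂ τ).mono (past_mono (Nat.le_succ _)) le_rfl).prodMk (measurable_past (Nat.lt_succ_self _))
  have hmeas : ∀ τ, Measurable[past ζ (2 * (τ + 1))] fun x =>
      6 / 7 * (conjNorm p (err (U₁ τ x, ζ (2 * τ) x)) ^ 2 / M ^ 2) +
        1 * (conjNorm p (err (U₂ τ x, ζ (2 * τ + 1) x)) ^ 2 / M ^ 2) := fun τ =>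
    (((hg (6 / 7)).comp (h₁ τ)).mono (past_mono (Nat.le_succ _)) le_rfl).add
      ((hg 1).comp (h₂ τ))
  -- Each step uses two noises: the later one is integrated first, at cost `exp 1`, then the earlier
  -- one, at cost `exp (6 / 7)`. The weights are `6 : 7` normalized so that the larger is 1, as
  -- Jensen requires.
  have h := lintegral_exp_sum_le (P := P) (κ := fun τ => 2 * τ) (c := 6 / 7 + 1) hmeas hκ
    (fun τ A hA => by
      simp only [Real.exp_add, ENNReal.ofReal_mul (Real.exp_pos _).le, ← mul_assoc (A _)]
      rw [← mul_assoc]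
      refine (lintegral_mul_past_le hζ hind (hU₂ τ) (g := fun q =>
        ENNReal.ofReal (Real.exp (1 * (conjNorm p (err q) ^ 2 / M ^ 2))))
        (((hA.mono (past_mono (Nat.le_succ _)) le_rfl)).mul ((hge (6 / 7)).comp (h₁ τ))) (hge 1)
        (fun x => lintegral_exp_mul_err_le hp hζ herr (hexp _ _) zero_le_one le_rfl)).trans ?_
      gcongr
      exact lintegral_mul_past_le hζ hind (hU₁ τ) hA (hge (6 / 7))
        (fun x => lintegral_exp_mul_err_le hp hζ herr (hexp _ _) (by norm_num) (by norm_num))) t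
  refine (measureReal_lt_le_exp (Finset.measurable_fun_sum _ fun τ _ =>
    (hmeas τ).mono (past_le hζ _) le_rfl) h).trans (Real.exp_le_exp.2 ?_)
  -- Only `6 / 7 + 1 ≤ 18 / 7` is needed; the value `18 / 7` is chosen to match `21 = 3 + 7 * (18 /
  -- 7)` in `K0`.
  have : (0 : ℝ) ≤ t := Nat.cast_nonneg t
  linarith

end OracleNoise

/-! ### Measurability of the iterates. -/

section Measurability

variable {E : Type*} [NormedAddCommGroup E] [InnerProductSpace ℝ E]
  {p : Seminorm ℝ E} {Z : Set E} {ω : E → ℝ} {ω' : E → E} {α : ℝ}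

theorem measurable_oracle [MeasurableSpace E] {S : Type*} [MeasurableSpace S] {Ξ : E → S → E}
    (hΞ : Measurable fun q : Z × S => Ξ q.1 q.2) :
    Measurable fun q : subdiffDomain Z ω × S => Ξ q.1 q.2 := by
  have h : Measurable fun z : subdiffDomain Z ω => (⟨z, z.2.1⟩ : Z) :=
    measurable_subtype_coe.subtype_mk
  exact hΞ.comp ((h.comp measurable_fst).prodMk measurable_snd)

variable [FiniteDimensional ℝ E]

theorem IsDistGen.continuous_prox (hω : IsDistGen p Z ω ω' α) (hZ : IsCompact Z)
    (hp : ∀ x, p x = 0 → x = 0) (hne : Z.Nonempty) :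
    Continuous fun q : subdiffDomain Z ω × E => prox Z ω ω' q.1 q.2 := by
  have hα := hω.modulus_pos
  obtain ⟨D, hD, hD'⟩ := exists_norm_le hp
  obtain ⟨C, hC, hC'⟩ := exists_conjNorm_le hp
  have hsel : Continuous fun q : subdiffDomain Z ω × E => ω' q.1 - q.2 :=
    ((continuousOn_iff_continuous_domRestrict.1 hω.selection_continuousOn).comp
      continuous_fst).sub continuous_snd
  refine continuous_iff_continuousAt.2 fun q₀ => ?_
  rw [ContinuousAt, tendsto_iff_norm_sub_tendsto_zero]
  have h0 := tendsto_iff_norm_sub_tendsto_zero.1 (hsel.tendsto q₀)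
  refine squeeze_zero (fun q => norm_nonneg _) (fun q => ?_)
    (by simpa using h0.const_mul (D * (α⁻¹ * C)))
  refine (hD' _).trans ?_
  rw [mul_assoc, mul_assoc]
  gcongr
  rw [← div_eq_inv_mul, le_div_iff₀ hα, mul_comm]
  exact (hω.dist_prox_le hZ hp hne _ _ _ _).trans (hC' _)

variable [MeasurableSpace E] [BorelSpace E] {S W : Type*} [MeasurableSpace S]
  {Ξ : E → S → E}

theorem IsDistGen.measurable_prox (hω : IsDistGen p Z ω ω' α) (hZ : IsCompact Z)
    (hp : ∀ x, p x = 0 → x = 0) (hne : Z.Nonempty) {mW : MeasurableSpace W} {r ξ : W → E}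
    (hr : ∀ x, r x ∈ subdiffDomain Z ω)
    (hrm : Measurable fun x => (⟨r x, hr x⟩ : subdiffDomain Z ω)) (hξ : Measurable ξ) :
    Measurable fun x => prox Z ω ω' (r x) (ξ x) :=
  Measurable.comp (g := fun q : subdiffDomain Z ω × E => prox Z ω ω' q.1 q.2)
    (f := fun x => (⟨r x, hr x⟩, ξ x)) (hω.continuous_prox hZ hp hne).measurable (hrm.prodMk hξ)

theorem measurable_oracle_error {F : E → E} (hF : Measurable fun z : Z => F z)
    (hΞ : Measurable fun q : Z × S => Ξ q.1 q.2) :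
    Measurable fun q : subdiffDomain Z ω × S => Ξ q.1 q.2 - F q.1 := by
  have h : Measurable fun z : subdiffDomain Z ω => (⟨z, z.2.1⟩ : Z) :=
    measurable_subtype_coe.subtype_mk
  exact (hΞ.comp ((h.comp measurable_fst).prodMk measurable_snd)).sub
    (hF.comp (h.comp measurable_fst))

variable (hω : IsDistGen p Z ω ω' α) (hZ : IsCompact Z) (hp : ∀ x, p x = 0 → x = 0)
  (hne : Z.Nonempty) (hΞ : Measurable fun q : Z × S => Ξ q.1 q.2) {r₀ : E}
  (hr₀ : r₀ ∈ subdiffDomain Z ω) (γ : ℕ → ℝ) (ζ : ℕ → W → S) (τ : ℕ)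
include hω hZ hp hne hΞ hr₀

theorem measurable_smpW_of_smpR
    (h : Measurable[past ζ (2 * τ)] fun x => smpR Z ω ω' Ξ r₀ γ (fun i => ζ i x) τ) :
    Measurable[past ζ (2 * τ + 1)] fun x => smpW Z ω ω' Ξ r₀ γ (fun i => ζ i x) τ := by
  have hm := (h.mono (past_mono (Nat.le_succ (2 * τ))) le_rfl).subtype_mk
    (h := fun x => smpR_mem hω.continuousOn hZ Ξ hr₀ γ (fun i => ζ i x) τ)
  exact hω.measurable_prox hZ hp hne _ hm
    (((measurable_oracle hΞ).comp (hm.prodMk (measurable_past (Nat.lt_succ_self _)))).const_smul _)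

theorem measurable_smpR :
    Measurable[past ζ (2 * τ)] fun x => smpR Z ω ω' Ξ r₀ γ (fun i => ζ i x) τ := by
  induction τ with
  | zero => exact measurable_const
  | succ τ ih =>
    have hm := (ih.mono (past_mono (by omega : 2 * τ ≤ 2 * (τ + 1))) le_rfl).subtype_mk
      (h := fun x => smpR_mem hω.continuousOn hZ Ξ hr₀ γ (fun i => ζ i x) τ)
    have hw := ((measurable_smpW_of_smpR hω hZ hp hne hΞ hr₀ γ ζ τ ih).mono
      (past_mono (by omega : 2 * τ + 1 ≤ 2 * (τ + 1))) le_rfl).subtype_mk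
      (h := fun x => smpW_mem hω.continuousOn hZ Ξ hr₀ γ (fun i => ζ i x) τ)
    exact hω.measurable_prox hZ hp hne _ hm (((measurable_oracle hΞ).comp
      (hw.prodMk (measurable_past (by omega : 2 * τ + 1 < 2 * (τ + 1))))).const_smul _)

theorem measurable_smpW :
    Measurable[past ζ (2 * τ + 1)] fun x => smpW Z ω ω' Ξ r₀ γ (fun i => ζ i x) τ :=
  measurable_smpW_of_smpR hω hZ hp hne hΞ hr₀ γ ζ τ
    (measurable_smpR hω hZ hp hne hΞ hr₀ γ ζ τ)

theorem measurable_smpAux {F : E → E} (hF : Measurable fun z : Z => F z) :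
    Measurable[past ζ (2 * τ)] fun x => smpAux Z ω ω' F Ξ r₀ γ (fun i => ζ i x) τ := by
  induction τ with
  | zero => exact measurable_const
  | succ τ ih =>
    have hm := (ih.mono (past_mono (by omega : 2 * τ ≤ 2 * (τ + 1))) le_rfl).subtype_mk
      (h := fun x => smpAux_mem hω.continuousOn hZ Ξ hr₀ γ (fun i => ζ i x) τ F)
    have hw := ((measurable_smpW hω hZ hp hne hΞ hr₀ γ ζ τ).mono
      (past_mono (by omega : 2 * τ + 1 ≤ 2 * (τ + 1))) le_rfl).subtype_mk
      (h := fun x => smpW_mem hω.continuousOn hZ Ξ hr₀ γ (fun i => ζ i x) τ)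
    exact hω.measurable_prox hZ hp hne _ hm ((((measurable_oracle_error hF hΞ).comp
      (hw.prodMk (measurable_past (by omega : 2 * τ + 1 < 2 * (τ + 1))))).const_smul (γ τ)).neg)

end Measurability

/-- The bounds for an error measure `G` that is dominated at an average of points of `Z` by the
regret of these points. -/
theorem error_bounds {E : Type*} [NormedAddCommGroup E] [InnerProductSpace ℝ E]
    [FiniteDimensional ℝ E] [MeasurableSpace E] [BorelSpace E] {p : Seminorm ℝ E}
    (hp : ∀ x, p x = 0 → x = 0) {Z : Set E} (hne : Z.Nonempty) (hZ : IsCompact Z)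
    {ω : E → ℝ} {ω' : E → E} {α : ℝ} (hω : IsDistGen p Z ω ω' α) {F : E → E}
    (hFmeas : Measurable fun z : Z => F z) {L M : ℝ} (hL : 0 ≤ L) (hM : 0 ≤ M)
    (hF : ∀ z ∈ Z, ∀ z' ∈ Z, conjNorm p (F z - F z') ≤ L * p (z - z') + M)
    {S : Type*} [MeasurableSpace S] {Ξ : E → S → E}
    (hΞ : Measurable fun q : Z × S => Ξ q.1 q.2) {W : Type*} [MeasurableSpace W]
    {P : Measure W} [IsProbabilityMeasure P] {ζ : ℕ → W → S} (hζ : ∀ i, Measurable (ζ i))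
    (hind : iIndepFun ζ P) {t : ℕ} (ht : 1 ≤ t) {γ : ℝ} (hγ : 0 < γ) (hγL : √3 * L * γ ≤ α)
    {μ : ℝ} (hμ : 0 ≤ μ) {G : E → ℝ} (hGc : ContinuousOn G Z)
    (hG : ∀ w : ℕ → E, (∀ τ, w τ ∈ Z) → ∀ c : ℝ,
      (∀ u ∈ Z, ∑ τ ∈ Finset.range t, ⟪F (w τ), w τ - u⟫ ≤ t * c) →
      G (∑ τ ∈ Finset.range t, (t : ℝ)⁻¹ • w τ) ≤ c)
    {zhat : W → E} (hzhat : zhat = fun x =>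
      smpOutput Z ω ω' Ξ (center Z ω) (fun _ => γ) (fun i => ζ i x) t)
    {Om : ℝ} (hOm : Om = Omega Z ω ω' α) (hI : AssumptionI p Z F Ξ P ζ μ M) :
    (Integrable (fun x => G (zhat x)) P ∧ ∫ x, G (zhat x) ∂P ≤ K0 α Om M μ γ t) ∧
      (AssumptionII p Z F Ξ P ζ M → ∀ Λ : ℝ, 0 < Λ →
        P.real {x | K0 α Om M μ γ t + Λ * K1 α Om M γ t < G (zhat x)} ≤
          Real.exp (-Λ ^ 2 / 3) + Real.exp (-Λ * t)) := by
  have hα := hω.modulus_pos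
  have ht' : (0 : ℝ) < t := by exact_mod_cast ht
  have hc := center_mem hZ hne hω.continuousOn
  have hOm0 : 0 ≤ Om := hOm ▸ Real.sqrt_nonneg _
  -- the iterates
  set r : ℕ → W → E := fun τ x => smpR Z ω ω' Ξ (center Z ω) (fun _ => γ) (fun i => ζ i x) τ
  set w : ℕ → W → E := fun τ x => smpW Z ω ω' Ξ (center Z ω) (fun _ => γ) (fun i => ζ i x) τ
  set y : ℕ → W → E := fun τ x => smpAux Z ω ω' F Ξ (center Z ω) (fun _ => γ) (fun i => ζ i x) τ
  have hr : ∀ τ x, r τ x ∈ subdiffDomain Z ω := fun τ x => smpR_mem hω.continuousOn hZ Ξ hc _ _ τ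
  have hw : ∀ τ x, w τ x ∈ subdiffDomain Z ω := fun τ x => smpW_mem hω.continuousOn hZ Ξ hc _ _ τ
  have hy : ∀ τ x, y τ x ∈ subdiffDomain Z ω :=
    fun τ x => smpAux_mem hω.continuousOn hZ Ξ hc _ _ τ F
  have hrm : ∀ τ, Measurable[past ζ (2 * τ)] (r τ) := measurable_smpR hω hZ hp hne hΞ hc _ ζ
  have hwm : ∀ τ, Measurable[past ζ (2 * τ + 1)] (w τ) := measurable_smpW hω hZ hp hne hΞ hc _ ζ
  have hym : ∀ τ, Measurable[past ζ (2 * τ + 1)] (y τ) := fun τ =>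
    (measurable_smpAux hω hZ hp hne hΞ hc _ ζ τ hFmeas).mono (past_mono (Nat.le_succ _)) le_rfl
  -- the oracle errors
  set err : subdiffDomain Z ω × S → E := fun q => Ξ q.1 q.2 - F q.1
  have herr : Measurable err := measurable_oracle_error hFmeas hΞ
  have hmom : ∀ (z : subdiffDomain Z ω) n,
      ∫⁻ x, ENNReal.ofReal (conjNorm p (err (z, ζ n x)) ^ 2) ∂P ≤ ENNReal.ofReal (M ^ 2) :=
    fun z n => hI.moment z z.2.1 n
  have hbias : ∀ (z : subdiffDomain Z ω) n, conjNorm p (∫ x, err (z, ζ n x) ∂P) ≤ μ :=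
    fun z n => hI.bias z z.2.1 n
  -- The iterates are taken with values in `Z^o`, since the oracle and `F` are measurable only on
  -- `Z`.
  set U₁ : ℕ → W → subdiffDomain Z ω := fun τ x => ⟨r τ x, hr τ x⟩
  set U₂ : ℕ → W → subdiffDomain Z ω := fun τ x => ⟨w τ x, hw τ x⟩
  have hU₁ : ∀ τ, Measurable[past ζ (2 * τ)] (U₁ τ) := fun τ => (hrm τ).subtype_mk
  have hU₂ : ∀ τ, Measurable[past ζ (2 * τ + 1)] (U₂ τ) := fun τ => (hwm τ).subtype_mk
  -- Normalized directions, as any two points of `Z` are at distance at most `2 * Om`. If `Om = 0`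
  -- the inverse is 0 and `V = 0`, which is consistent because then `y = w`.
  set V : ℕ → W → E := fun τ x => (2 * Om)⁻¹ • (y τ x - w τ x)
  have hV : ∀ τ, Measurable[past ζ (2 * τ + 1)] (V τ) := fun τ =>
    ((hym τ).sub (hwm τ)).const_smul _
  have hdist : ∀ τ x, p (y τ x - w τ x) ≤ 2 * Om := fun τ x =>
    hOm ▸ hω.dist_le hZ (hy τ x).1 (hw τ x).1
  have hV1 : ∀ τ x, p (V τ x) ≤ 1 := fun τ x => by
    rw [map_smul_eq_mul, norm_inv, Real.norm_of_nonneg (by positivity)]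
    exact inv_mul_le_one_of_le₀ (hdist τ x) (by positivity)
  have hyw : ∀ τ x, y τ x - w τ x = (2 * Om) • V τ x := fun τ x => by
    rcases hOm0.eq_or_lt with h0 | h0
    · have h1 := hdist τ x
      rw [← h0, mul_zero] at h1
      rw [← h0, mul_zero, zero_smul]
      exact hp _ (le_antisymm h1 (apply_nonneg p _))
    · exact (smul_inv_smul₀ (by positivity) _).symm
  set a : ℕ → W → ℝ := fun τ x => conjNorm p (err (U₁ τ x, ζ (2 * τ) x)) ^ 2
  set b : ℕ → W → ℝ := fun τ x => conjNorm p (err (U₂ τ x, ζ (2 * τ + 1) x)) ^ 2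
  set d : ℕ → W → ℝ := fun τ x => ⟪err (U₂ τ x, ζ (2 * τ + 1) x), V τ x⟫
  have ha : ∀ τ, Integrable (a τ) P ∧ ∫ x, a τ x ∂P ≤ M ^ 2 := fun τ =>
    integrable_sq_err hp hζ herr hind (hU₁ τ) fun z => hmom z _
  have hb : ∀ τ, Integrable (b τ) P ∧ ∫ x, b τ x ∂P ≤ M ^ 2 := fun τ =>
    integrable_sq_err hp hζ herr hind (hU₂ τ) fun z => hmom z _
  have hd : ∀ τ, Integrable (d τ) P ∧ ∫ x, d τ x ∂P ≤ μ := fun τ =>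
    integrable_inner_err hp hζ herr hind (hU₂ τ) (hV τ) (hV1 τ) (fun z => hmom z _)
      fun z => hbias z _
  -- the pointwise bound
  set B : W → ℝ := fun x => (α * Om ^ 2 + ∑ τ ∈ Finset.range t,
    (γ ^ 2 / (2 * α) * (3 * M ^ 2 + 6 * a τ x + 7 * b τ x) + γ * (2 * Om * d τ x))) / (t * γ)
  have hzhat' : ∀ x, zhat x = ∑ τ ∈ Finset.range t, (t : ℝ)⁻¹ • w τ x := fun x => by
    rw [hzhat]
    exact smpOutput_const Z ω ω' Ξ _ hγ.ne' _ t
  have hGB : ∀ x, G (zhat x) ≤ B x := fun x => by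
    rw [hzhat']
    refine hG (fun τ => w τ x) (fun τ => (hw τ x).1) _ fun u hu => ?_
    have h := sum_inner_le hω hZ hp hL hF hγ hγL Ξ (fun i => ζ i x) rfl rfl rfl t hu
    have h2 : (t : ℝ) * B x = (α * Om ^ 2 + ∑ τ ∈ Finset.range t,
        (γ ^ 2 / (2 * α) * (3 * M ^ 2 + 6 * a τ x + 7 * b τ x) + γ * (2 * Om * d τ x))) / γ := by
      simp only [B]
      field_simp
    rw [h2, le_div_iff₀ hγ, mul_comm]
    refine h.trans (le_of_eq ?_)
    rw [← hOm, add_assoc, Finset.mul_sum, Finset.mul_sum, ← Finset.sum_add_distrib]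
    congr 1
    refine Finset.sum_congr rfl fun τ _ => ?_
    change _ + γ * ⟪_, y τ x - w τ x⟫ = _
    rw [hyw, inner_smul_right]
  have hzhatZ : ∀ x, zhat x ∈ Z := fun x => by
    rw [hzhat']
    refine hω.convexOn.1.sum_mem (fun _ _ => by positivity) ?_ fun τ _ => (hw τ x).1
    rw [Finset.sum_const, Finset.card_range, nsmul_eq_mul, mul_inv_cancel₀ ht'.ne']
  have hzhatm : Measurable zhat := by
    rw [show zhat = fun x => ∑ τ ∈ Finset.range t, (t : ℝ)⁻¹ • w τ x from funext hzhat']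
    exact Finset.measurable_fun_sum _ fun τ _ =>
      ((hwm τ).mono (past_le hζ _) le_rfl).const_smul _
  have hGm : Measurable fun x => G (zhat x) :=
    (continuousOn_iff_continuous_domRestrict.1 hGc).measurable.comp
      (hzhatm.subtype_mk (h := hzhatZ))
  have hGi : Integrable (fun x => G (zhat x)) P := by
    obtain ⟨C, hC⟩ := hZ.exists_bound_of_continuousOn hGc
    exact (integrable_const C).mono' hGm.aestronglyMeasurable
      (.of_forall fun x => hC _ (hzhatZ x))
  refine ⟨⟨hGi, ?_⟩, fun hII Λ hΛ => ?_⟩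
  · -- the expectation
    have hterm : ∀ τ, Integrable (fun x => γ ^ 2 / (2 * α) * (3 * M ^ 2 + 6 * a τ x + 7 * b τ x) +
          γ * (2 * Om * d τ x)) P ∧
        ∫ x, (γ ^ 2 / (2 * α) * (3 * M ^ 2 + 6 * a τ x + 7 * b τ x) + γ * (2 * Om * d τ x)) ∂P ≤
          γ ^ 2 / (2 * α) * (16 * M ^ 2) + γ * (2 * Om * μ) := fun τ => by
      have i1 : Integrable (fun x => 3 * M ^ 2 + 6 * a τ x) P :=
        (integrable_const _).add ((ha τ).1.const_mul 6)
      have i2 : Integrable (fun x => 3 * M ^ 2 + 6 * a τ x + 7 * b τ x) P :=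
        i1.add ((hb τ).1.const_mul 7)
      have i3 : Integrable (fun x => γ * (2 * Om * d τ x)) P :=
        ((hd τ).1.const_mul _).const_mul _
      refine ⟨(i2.const_mul _).add i3, ?_⟩
      rw [integral_add (i2.const_mul _) i3, integral_const_mul,
        integral_add i1 ((hb τ).1.const_mul 7),
        integral_add (integrable_const _) ((ha τ).1.const_mul 6)]
      simp only [integral_const, integral_const_mul, probReal_univ, smul_eq_mul, one_mul]
      gcongr
      · linarith [(ha τ).2, (hb τ).2]
      · exact (hd τ).2
    have hsum : Integrable (fun x => ∑ τ ∈ Finset.range t,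
        (γ ^ 2 / (2 * α) * (3 * M ^ 2 + 6 * a τ x + 7 * b τ x) + γ * (2 * Om * d τ x))) P :=
      integrable_finsetSum _ fun τ _ => (hterm τ).1
    have hB : Integrable B P := ((integrable_const _).add hsum).div_const _
    refine (integral_mono hGi hB hGB).trans ?_
    simp only [B]
    rw [integral_div, integral_add (integrable_const _) hsum,
      integral_finsetSum _ fun τ _ => (hterm τ).1]
    simp only [integral_const, probReal_univ, smul_eq_mul, one_mul]
    rw [div_le_iff₀ (by positivity)]
    refine (add_le_add_right (Finset.sum_le_sum fun τ _ => (hterm τ).2) _).trans ?_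
    rw [Finset.sum_const, Finset.card_range, nsmul_eq_mul]
    have h1 : K0 α Om M μ γ t * (t * γ) =
        α * Om ^ 2 + t * (γ ^ 2 / (2 * α) * (21 * M ^ 2) + γ * (2 * Om * μ)) := by
      simp only [K0]
      field_simp
      ring
    -- The expectation yields the coefficient `3 + 6 + 7 = 16`; the 21 in `K0` is what the deviation
    -- bound uses.
    rw [h1]
    gcongr
    norm_num
  · -- the deviations
    rcases hM.eq_or_lt with hM0 | hMpos
    -- For `M = 0` the quotient by `M ^ 2` is 0 by convention and Assumption II says nothing, but
    -- the second moments force all oracle errors to vanish almost surely, so the bad event is null.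
    · have ha0 : ∀ τ, ∀ᵐ x ∂P, a τ x = 0 := fun τ => by
        refine (integral_eq_zero_iff_of_nonneg (fun x => sq_nonneg _) (ha τ).1).1
          (le_antisymm ?_ (integral_nonneg fun x => sq_nonneg _))
        simpa [← hM0] using (ha τ).2
      have hb0 : ∀ τ, ∀ᵐ x ∂P, b τ x = 0 := fun τ => by
        refine (integral_eq_zero_iff_of_nonneg (fun x => sq_nonneg _) (hb τ).1).1
          (le_antisymm ?_ (integral_nonneg fun x => sq_nonneg _))
        simpa [← hM0] using (hb τ).2
      have hzero : P.real {x | K0 α Om M μ γ t + Λ * K1 α Om M γ t < G (zhat x)} = 0 := by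
        rw [measureReal_def, ENNReal.toReal_eq_zero_iff]
        left
        have : ∀ᵐ x ∂P, ¬ (K0 α Om M μ γ t + Λ * K1 α Om M γ t < G (zhat x)) := by
          filter_upwards [ae_all_iff.2 ha0, ae_all_iff.2 hb0] with x hxa hxb
          have hxd : ∀ τ, d τ x ≤ 0 := fun τ => by
            have h1 : conjNorm p (err (U₂ τ x, ζ (2 * τ + 1) x)) = 0 :=
              pow_eq_zero_iff two_ne_zero |>.1 (hxb τ)
            exact h1 ▸ inner_le_conjNorm_of_le_one hp _ (hV1 τ x)
          rw [not_lt]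
          refine (hGB x).trans ?_
          have h2 : B x ≤ α * Om ^ 2 / (t * γ) := by
            simp only [B]
            gcongr
            refine add_le_of_nonpos_right (Finset.sum_nonpos fun τ _ => ?_)
            rw [hxa, hxb, ← hM0]
            have := mul_nonpos_of_nonneg_of_nonpos (by positivity : 0 ≤ γ * (2 * Om)) (hxd τ)
            linarith
          have h3 : 0 ≤ 2 * μ * Om := by positivity
          simp only [K0, K1, ← hM0]
          norm_num
          linarith
        rw [ae_iff] at this
        simpa only [not_not] using this
      rw [hzero]
      positivity
    have hexp : ∀ (z : subdiffDomain Z ω) n,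
        ∫⁻ x, ENNReal.ofReal (Real.exp (conjNorm p (err (z, ζ n x)) ^ 2 / M ^ 2)) ∂P ≤
          ENNReal.ofReal (Real.exp 1) := fun z n => hII z z.2.1 n
    have h1 := measureReal_sum_inner_err_le hp hζ herr hind hMpos (κ := fun τ => 2 * τ + 1)
      (fun m n h => by simpa using h) hU₂ hV hV1 hmom hbias hexp ht hΛ
    have h2 := measureReal_sum_sq_err_le hp hζ herr hind (M := M) hU₁ hU₂ hexp t (Λ := Λ)
    -- A union bound: outside the two deviation events the pathwise bound `B` is at most `K0 + Λ *
    -- K1`.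
    refine le_trans (le_trans (measureReal_mono ?_) (measureReal_union_le _ _)) (add_le_add h1 h2)
    intro x hx
    rw [mem_ofPred_eq] at hx
    by_contra hnot
    rw [mem_union, not_or] at hnot
    obtain ⟨hn1, hn2⟩ := hnot
    rw [mem_ofPred_eq, not_lt] at hn1 hn2
    change ∑ τ ∈ Finset.range t, d τ x / M ≤ _ at hn1
    change ∑ τ ∈ Finset.range t, (6 / 7 * (a τ x / M ^ 2) + 1 * (b τ x / M ^ 2)) ≤ _ at hn2
    have hd' : ∑ τ ∈ Finset.range t, d τ x ≤ t * μ + M * (Λ * √t) := by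
      rw [← Finset.sum_div, div_le_iff₀ hMpos] at hn1
      refine hn1.trans (le_of_eq ?_)
      field_simp
    have hab : ∑ τ ∈ Finset.range t, (3 * M ^ 2 + 6 * a τ x + 7 * b τ x) ≤
        M ^ 2 * (21 * t + 7 * Λ * t) := by
      have e : ∑ τ ∈ Finset.range t, (3 * M ^ 2 + 6 * a τ x + 7 * b τ x) =
          t * (3 * M ^ 2) + 7 * M ^ 2 *
            ∑ τ ∈ Finset.range t, (6 / 7 * (a τ x / M ^ 2) + 1 * (b τ x / M ^ 2)) := by
        rw [Finset.mul_sum, ← nsmul_eq_mul, ← Finset.card_range t, ← Finset.sum_const,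
          Finset.card_range, ← Finset.sum_add_distrib]
        refine Finset.sum_congr rfl fun τ _ => ?_
        field_simp
        ring
      rw [e]
      have := mul_le_mul_of_nonneg_left hn2 (by positivity : 0 ≤ 7 * M ^ 2)
      linarith
    refine absurd (hGB x) (not_le.2 (lt_of_le_of_lt ?_ hx))
    simp only [B]
    rw [div_le_iff₀ (by positivity), Finset.sum_add_distrib, ← Finset.mul_sum, ← Finset.mul_sum,
      ← Finset.mul_sum]
    have h3 : (K0 α Om M μ γ t + Λ * K1 α Om M γ t) * (t * γ) =
        α * Om ^ 2 + (γ ^ 2 / (2 * α) * (M ^ 2 * (21 * t + 7 * Λ * t)) +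
          γ * (2 * Om * (t * μ + M * (Λ * √t)))) := by
      have hst : √(t : ℝ) ≠ 0 := (Real.sqrt_pos.2 ht').ne'
      have hsq : (t : ℝ) = √t * √t := (Real.mul_self_sqrt ht'.le).symm
      have h4 : 2 * M * Om / √t * t = 2 * M * Om * √t := by
        rw [div_mul_eq_mul_div, div_eq_iff hst]
        linear_combination (2 * M * Om) * hsq
      have h5 : K0 α Om M μ γ t * (t * γ) =
          α * Om ^ 2 + t * (γ ^ 2 / (2 * α) * (21 * M ^ 2) + γ * (2 * Om * μ)) := by
        simp only [K0]
        field_simp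
        ring
      have h6 : 7 * M ^ 2 * γ / (2 * α) = γ / (2 * α) * (7 * M ^ 2) := by ring
      rw [add_mul, h5, K1, h6]
      linear_combination (Λ * γ) * h4
    rw [h3]
    gcongr

end SMP

/-! ### The two error measures. -/

theorem mainTheorem1
    {E : Type*} [NormedAddCommGroup E] [InnerProductSpace ℝ E] [FiniteDimensional ℝ E]
    [MeasurableSpace E] [BorelSpace E]
    -- the norm on `E`, not necessarily the Euclidean one
    (p : Seminorm ℝ E) (hp : ∀ x, p x = 0 → x = 0)
    -- the domain and the distance-generating function
    (Z : Set E) (hZne : Z.Nonempty) (hZconv : Convex ℝ Z) (hZcomp : IsCompact Z)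
    (ω : E → ℝ) (ω' : E → E) (α : ℝ) (hω : SMP.IsDistGen p Z ω ω' α)
    -- the monotone operator
    (F : E → E) (hFmeas : Measurable fun z : Z => F z)
    (hFmono : ∀ z ∈ Z, ∀ z' ∈ Z, 0 ≤ ⟪F z - F z', z - z'⟫)
    (L M : ℝ) (hL : 0 ≤ L) (hM : 0 ≤ M)
    (hF : ∀ z ∈ Z, ∀ z' ∈ Z, SMP.conjNorm p (F z - F z') ≤ L * p (z - z') + M)
    -- the stochastic oracle and its i.i.d. noises
    {N : ℕ} (Ξ : E → (Fin N → ℝ) → E)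
    (hΞ : Measurable fun q : Z × (Fin N → ℝ) => Ξ q.1 q.2)
    {W : Type*} [MeasurableSpace W] (P : Measure W) [IsProbabilityMeasure P]
    (ζ : ℕ → W → (Fin N → ℝ)) (hζmeas : ∀ i, Measurable (ζ i)) (hζindep : iIndepFun ζ P)
    (hζident : ∀ i, IdentDistrib (ζ i) (ζ 0) P P)
    -- the number of steps and the constant stepsize, `γ ≤ α / (√3 L)`
    (t : ℕ) (ht : 1 ≤ t) (γ : ℝ) (hγ : 0 < γ) (hγL : √3 * L * γ ≤ α)
    (μ : ℝ) (hμ : 0 ≤ μ)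
    -- the random approximate solution produced by the algorithm
    (zhat : W → E)
    (hzhat : zhat = fun x =>
      SMP.smpOutput Z ω ω' Ξ (SMP.center Z ω) (fun _ => γ) (fun i => ζ i x) t)
    (Om : ℝ) (hOm : Om = SMP.Omega Z ω ω' α) :
    -- the bounds for `Err_vi`
    ((SMP.AssumptionI p Z F Ξ P ζ μ M →
        Integrable (fun x => SMP.errVI Z F (zhat x)) P ∧
        ∫ x, SMP.errVI Z F (zhat x) ∂P ≤ SMP.K0 α Om M μ γ t) ∧
      (SMP.AssumptionI p Z F Ξ P ζ μ M → SMP.AssumptionII p Z F Ξ P ζ M →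
        ∀ Λ : ℝ, 0 < Λ →
          P.real {x | SMP.K0 α Om M μ γ t + Λ * SMP.K1 α Om M γ t < SMP.errVI Z F (zhat x)}
            ≤ Real.exp (-Λ ^ 2 / 3) + Real.exp (-Λ * t))) ∧
    -- the same bounds for `Err_N` if the v.i. is a Nash v.i.
    (∀ {m : ℕ} {H : Fin m → Type*} [∀ i, NormedAddCommGroup (H i)]
        [∀ i, InnerProductSpace ℝ (H i)] (e : E ≃ₗᵢ[ℝ] PiLp 2 H)
        (X : ∀ i, Set (H i)) (φ : Fin m → PiLp 2 H → ℝ),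
      SMP.IsConvexNash X φ → e '' Z = SMP.prodSet X →
      SMP.IsNashOperator X φ (fun y => e (F (e.symm y))) →
      (SMP.AssumptionI p Z F Ξ P ζ μ M →
        Integrable (fun x => SMP.errN X φ (e (zhat x))) P ∧
        ∫ x, SMP.errN X φ (e (zhat x)) ∂P ≤ SMP.K0 α Om M μ γ t) ∧
      (SMP.AssumptionI p Z F Ξ P ζ μ M → SMP.AssumptionII p Z F Ξ P ζ M →
        ∀ Λ : ℝ, 0 < Λ →
          P.real {x | SMP.K0 α Om M μ γ t + Λ * SMP.K1 α Om M γ t < SMP.errN X φ (e (zhat x))}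
            ≤ Real.exp (-Λ ^ 2 / 3) + Real.exp (-Λ * t))) := by
  have bounds : ∀ G : E → ℝ, ContinuousOn G Z →
      (∀ w : ℕ → E, (∀ τ, w τ ∈ Z) → ∀ c : ℝ,
        (∀ u ∈ Z, ∑ τ ∈ Finset.range t, ⟪F (w τ), w τ - u⟫ ≤ t * c) →
        G (∑ τ ∈ Finset.range t, (t : ℝ)⁻¹ • w τ) ≤ c) →
      (SMP.AssumptionI p Z F Ξ P ζ μ M →
        Integrable (fun x => G (zhat x)) P ∧ ∫ x, G (zhat x) ∂P ≤ SMP.K0 α Om M μ γ t) ∧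
      (SMP.AssumptionI p Z F Ξ P ζ μ M → SMP.AssumptionII p Z F Ξ P ζ M → ∀ Λ : ℝ, 0 < Λ →
        P.real {x | SMP.K0 α Om M μ γ t + Λ * SMP.K1 α Om M γ t < G (zhat x)} ≤
          Real.exp (-Λ ^ 2 / 3) + Real.exp (-Λ * t)) := fun G hGc hG =>
    have h := SMP.error_bounds hp hZne hZcomp hω hFmeas hL hM hF hΞ hζmeas hζindep ht hγ hγL hμ
      hGc hG hzhat hOm
    ⟨fun hI => (h hI).1, fun hI => (h hI).2⟩
  constructor
  · obtain ⟨K, hK, hFK⟩ := SMP.exists_norm_operator_le hp hZcomp hL hF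
    exact bounds _ (SMP.errVI_continuous hZne hZcomp hK hFK).continuousOn
      fun w hw c hc => SMP.errVI_average_le hZne hFmono ht hw hc
  · intro m H _ _ e X φ hN heZ hop
    have hmaps : ∀ z ∈ Z, e z ∈ SMP.prodSet X := fun z hz => heZ ▸ Set.mem_image_of_mem e hz
    refine bounds (fun z => SMP.errN X φ (e z))
      (hN.errN_continuousOn.comp e.continuous.continuousOn hmaps) fun w hw c hc => ?_
    simp only [map_sum, map_smul]
    refine hN.errN_average_le hop ht (fun τ => hmaps _ (hw τ)) fun u hu => ?_
    rw [← heZ] at hu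
    obtain ⟨u, hu, rfl⟩ := hu
    -- The isometry `e` preserves inner products, so the regret is the same in `E` and in the
    -- product space.
    simpa only [e.symm_apply_apply, ← map_sub, e.inner_map_map] using hc u hu
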